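/- Notation. For $z=(x,\xi)\in\mathbb R^{2d}$ let $\pi(z)f(t)=e^{2\pi i\xi\cdot t}f(t-x)$, and for $z\in\mathbb R^{2d}$ and $s\ge 0$ let $v_s(z)=(1+|z|^2)^{s/2}$. Fix a window $g\in\mathcal S(\mathbb R^d)\setminus\{0\}$. For $f\in\mathcal S'(\mathbb R^d)$ let $V_gf(z)=\langle f,\pi(z)g\rangle$, and let $M^p_{v_s}(\mathbb R^d)$ be the space of all $f\in\mathcal S'(\mathbb R^d)$ with $v_sV_gf\in L^p(\mathbb R^{2d})$. Let $L^p_{v_s}(\mathbb R^{2d})$ be the space of measurable $F$ with $v_sF\in L^p(\mathbb R^{2d})$, regarded as tempered distributions. For $n\ge 0$ the metaplectic operators on $\mathbb R^n$ are the operators generated, under composition and inversion, by the unimodular constants (with projection the identity matrix), the Fourier transform $\mathcal F\varphi(\xi)=\int e^{-2\pi i t\cdot\xi}\varphi(t)\,dt$ (with projection $\begin{pmatrix}0&I\\-I&0\end{pmatrix}$), the rescalings $\varphi\mapsto|\det L|^{1/2}\varphi(L\,\cdot)$ with $L\in GL(n,\mathbb R)$ (with projection $\begin{pmatrix}L^{-1}&0\\0&L^T\end{pmatrix}$)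 and the multiplications by $e^{i\pi Cx\cdot x}$ with $C=C^T$ (with projection $\begin{pmatrix}I&0\\C&I\end{pmatrix}$); projections multiply when operators are composed. They act on $\mathcal S(\mathbb R^n)$, are $L^2$-unitary, and extend to $\mathcal S'(\mathbb R^n)$. For $\mathcal A\in Sp(2d,\mathbb R)$ (real $4d\times 4d$ symplectic matrices) let $\mu(\mathcal A)$ be a metaplectic operator on $\mathbb R^{2d}$ with projection $\mathcal A$; it is determined up to a unimodular factor, whose choice is immaterial. For $f,h\in\mathcal S'(\mathbb R^d)$ put $$W_{\mathcal A}(f,h)=\mu(\mathcal A)(f\otimes\bar h)\in\mathcal S'(\mathbb R^{2d}),\qquad W_{\mathcal A}f=W_{\mathcal A}(f,f).$$ $W_{\mathcal A}$ is called shift-invertible if there is $E\in GL(2d,\mathbb R)$ such that for all $f,h\in L^2(\mathbb R^d)$ and $w\in\mathbb R^{2d}$, $$|W_{\mathcal A}(\pi(w)f,h)(z)|=|W_{\mathcal A}(f,h)(z-Ew)|\quad\text{for a.e. }z\in\mathbb R^{2d}.$$ Corollary. Let $s\ge 0$, $1\le p\le 2$, and let $\mathcal A\in Sp(2d,\mathbb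 R)$ be such that $W_{\mathcal A}$ is shift-invertible. Then, for every $f\in\mathcal S'(\mathbb R^d)$ (and every window $g\in\mathcal S(\mathbb R^d)\setminus\{0\}$), $$f\in M^p_{v_s}(\mathbb R^d)\iff W_{\mathcal A}f\in L^p_{v_s}(\mathbb R^{2d}).$$ -/

import Mathlib

open MeasureTheory SchwartzMap LineDeriv
open scoped ContDiff ENNReal

namespace TimeFreq

/-- Schwartz seminorm bound for the first order Taylor remainder of a Schwartz function. -/
theorem schwartz_taylor {V : Type} [NormedAddCommGroup V] [NormedSpace ℝ V] (n : ℕ) :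
    ∀ (F : Type) [NormedAddCommGroup F] [NormedSpace ℝ F] (φ : 𝓢(V, F)) (k : ℕ),
      ∃ C : ℝ, 0 ≤ C ∧ ∀ h : V, ‖h‖ ≤ 1 → ∀ z : V,
        ‖z‖ ^ k * ‖iteratedFDeriv ℝ n (fun y => φ (y + h) - φ y - fderiv ℝ φ y h) z‖
          ≤ C * ‖h‖ ^ 2 := by
  induction n with
  | zero =>
    intro F _ _ φ k
    set Φ := fderivCLM ℝ V (V →L[ℝ] F) (fderivCLM ℝ V F φ) with hΦ
    set M := 2 ^ k * ((Finset.Iic (k, 0)).sup fun m => SchwartzMap.seminorm ℝ m.1 m.2) Φ with hM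
    have hM0 : 0 ≤ M := by positivity
    refine ⟨M, hM0, fun h hh z => ?_⟩
    have key : ∀ w : V, ‖w - z‖ ≤ 1 → ‖z‖ ^ k * ‖fderiv ℝ (fderiv ℝ φ) w‖ ≤ M := by
      intro w hw
      have h1 : (1 + ‖w‖) ^ k * ‖iteratedFDeriv ℝ 0 Φ w‖ ≤ M :=
        one_add_le_sup_seminorm_apply (𝕜 := ℝ) (m := (k, 0)) le_rfl le_rfl Φ w
      rw [norm_iteratedFDeriv_zero] at h1
      have h2 : ‖z‖ ≤ 1 + ‖w‖ := by
        have := norm_sub_norm_le z w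
        rw [norm_sub_rev] at this
        linarith
      have h3 : Φ w = fderiv ℝ (fderiv ℝ φ) w := by
        rw [hΦ, fderivCLM_apply]; rfl
      rw [← h3]
      exact le_trans (by gcongr) h1
    have hseg : ∀ w ∈ segment ℝ z (z + h), ‖w - z‖ ≤ ‖h‖ := by
      intro w hw
      have := norm_sub_le_of_mem_segment hw
      simpa using this
    have hd1 : ∀ w, DifferentiableAt ℝ φ w := fun w => φ.differentiableAt
    have hd2 : ∀ w, DifferentiableAt ℝ (fderiv ℝ φ) w := fun w =>
      (fderivCLM ℝ V F φ).differentiableAt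
    rw [norm_iteratedFDeriv_zero]
    have hc0 : 0 ≤ ‖z‖ ^ k := by positivity
    rcases hc0.eq_or_lt with hz | hz
    · rw [← hz, zero_mul]; positivity
    · have b2 : ∀ w ∈ segment ℝ z (z + h), ‖fderiv ℝ (fderiv ℝ φ) w‖ ≤ M / ‖z‖ ^ k := by
        intro w hw
        rw [le_div_iff₀' hz]
        exact key w ((hseg w hw).trans hh)
      have b1 : ∀ w ∈ segment ℝ z (z + h),
          ‖fderiv ℝ φ w - fderiv ℝ φ z‖ ≤ M / ‖z‖ ^ k * ‖h‖ := by
        intro w hw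
        refine ((convex_segment z (z + h)).norm_image_sub_le_of_norm_fderiv_le
          (fun u _ => hd2 u) b2 (left_mem_segment ℝ _ _) hw).trans ?_
        gcongr
        exact hseg w hw
      have b0 := (convex_segment z (z + h)).norm_image_sub_le_of_norm_fderiv_le'
          (fun u _ => hd1 u) b1 (left_mem_segment ℝ _ _) (right_mem_segment ℝ _ _)
      rw [add_sub_cancel_left] at b0
      calc _ ≤ ‖z‖ ^ k * (M / ‖z‖ ^ k * ‖h‖ * ‖h‖) := by gcongr
        _ = M * ‖h‖ ^ 2 := by field_simp
  | succ n ih =>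
    intro F _ _ φ k
    obtain ⟨C, hC, H⟩ := ih (V →L[ℝ] F) (fderivCLM ℝ V F φ) k
    refine ⟨C, hC, fun h hh z => ?_⟩
    rw [← norm_iteratedFDeriv_fderiv]
    convert! H h hh z using 4
    funext y
    have hd1 : ∀ w, HasFDerivAt φ (fderiv ℝ φ w) w := fun w => φ.differentiableAt.hasFDerivAt
    have hd2 : ∀ w, HasFDerivAt (fderiv ℝ φ) (fderiv ℝ (fderiv ℝ φ) w) w := fun w =>
      ((fderivCLM ℝ V F φ).differentiableAt (x := w)).hasFDerivAt
    have e1 : HasFDerivAt (fun y => φ (y + h)) (fderiv ℝ φ (y + h)) y := (hasFDerivAt_comp_add_right h).2 (hd1 (y + h))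
    have e2 : HasFDerivAt (fun y => fderiv ℝ φ y h) ((fderiv ℝ (fderiv ℝ φ) y).flip h) y := by
      simpa using (hd2 y).clm_apply (hasFDerivAt_const h y)
    have e3 := ((e1.sub (hd1 y)).sub e2).fderiv
    refine e3.trans ?_
    have hs : IsSymmSndFDerivAt ℝ φ y :=
      (φ.contDiffAt 2).isSymmSndFDerivAt (by simp)
    ext v
    have := hs v h
    simp only [fderivCLM_apply, sub_apply, ContinuousLinearMap.flip_apply]
    rw [this]
    rfl

section Slice
variable {V W : Type} [NormedAddCommGroup V] [NormedSpace ℝ V]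
  [NormedAddCommGroup W] [NormedSpace ℝ W]

/-- The slice `y ↦ φ (x, y)` of a Schwartz function on a product. -/
noncomputable def sliceCLM (x : V) : 𝓢(V × W, ℂ) →L[ℂ] 𝓢(W, ℂ) :=
  compCLMOfAntilipschitz (K := 1) (g := fun y : W => (x, y)) ℂ
    (by
      have h : (fun y : W => (x, y)) = fun y => ContinuousLinearMap.inr ℝ V W y + (x, 0) := by
        ext y <;> simp
      rw [h]
      exact (ContinuousLinearMap.hasTemperateGrowth _).add (Function.HasTemperateGrowth.const _))
    (fun y y' => by simp [Prod.edist_eq])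

theorem sliceCLM_apply (x : V) (φ : 𝓢(V × W, ℂ)) (y : W) : sliceCLM x φ y = φ (x, y) := rfl

theorem seminorm_sliceCLM_le (φ : 𝓢(V × W, ℂ)) (x : V) (k j n : ℕ) :
    ‖x‖ ^ k * SchwartzMap.seminorm ℂ j n (sliceCLM x φ) ≤ SchwartzMap.seminorm ℂ (k + j) n φ := by
  have hp : ‖x‖ ^ k * SchwartzMap.seminorm ℂ j n (sliceCLM x φ)
      = SchwartzMap.seminorm ℂ j n (((‖x‖ ^ k : ℝ) : ℂ) • sliceCLM x φ) := by
    rw [map_smul_eq_mul, Complex.norm_real, Real.norm_of_nonneg (by positivity)]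
  rw [hp]
  refine SchwartzMap.seminorm_le_bound ℂ j n _ (by positivity) fun y => ?_
  have h1 : iteratedFDeriv ℝ n (((‖x‖ ^ k : ℝ) : ℂ) • sliceCLM x φ) y
      = (‖x‖ ^ k : ℝ) • iteratedFDeriv ℝ n (sliceCLM x φ) y := by
    have : (⇑(((‖x‖ ^ k : ℝ) : ℂ) • sliceCLM x φ) : W → ℂ) = (‖x‖ ^ k : ℝ) • ⇑(sliceCLM x φ) := by
      ext y; simp
    rw [this, iteratedFDeriv_const_smul_apply ((sliceCLM x φ).contDiffAt n)]
  have h2 : iteratedFDeriv ℝ n (sliceCLM x φ) y = (iteratedFDeriv ℝ n φ (x, y)).compContinuousLinearMap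
      fun _ => ContinuousLinearMap.inr ℝ V W := by
    have e : (⇑(sliceCLM x φ) : W → ℂ) = (fun z => φ ((x, 0) + z)) ∘ ContinuousLinearMap.inr ℝ V W := by
      ext y; simp [sliceCLM_apply]
    rw [e, ContinuousLinearMap.iteratedFDeriv_comp_right (n := ∞) _ _ _ (by exact_mod_cast le_top),
      iteratedFDeriv_comp_add_left]
    · simp
    · exact (φ.smooth ⊤).comp (contDiff_const.add contDiff_id)
  have h3 : ‖iteratedFDeriv ℝ n (sliceCLM x φ) y‖ ≤ ‖iteratedFDeriv ℝ n φ (x, y)‖ := by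
    rw [h2]
    refine (ContinuousMultilinearMap.norm_compContinuousLinearMap_le _ _).trans ?_
    refine mul_le_of_le_one_right (norm_nonneg _) (Finset.prod_le_one (fun _ _ => norm_nonneg _) ?_)
    intro _ _
    exact ContinuousLinearMap.opNorm_le_bound _ zero_le_one fun w => by simp
  rw [h1, norm_smul, Real.norm_of_nonneg (by positivity)]
  have hx : ‖x‖ ≤ ‖(x, y)‖ := by simp [Prod.norm_def]
  have hy : ‖y‖ ≤ ‖(x, y)‖ := by simp [Prod.norm_def]
  calc _ = (‖x‖ ^ k * ‖y‖ ^ j) * ‖iteratedFDeriv ℝ n (sliceCLM x φ) y‖ := by ring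
    _ ≤ (‖(x, y)‖ ^ k * ‖(x, y)‖ ^ j) * ‖iteratedFDeriv ℝ n φ (x, y)‖ := by gcongr
    _ = ‖(x, y)‖ ^ (k + j) * ‖iteratedFDeriv ℝ n φ (x, y)‖ := by rw [pow_add]
    _ ≤ _ := SchwartzMap.le_seminorm ℂ _ _ _ _

/-- Continuity bound for `x ↦ ⟨T, φ (x, ·)⟩`. -/
theorem slice_bound (T : 𝓢(W, ℂ) →L[ℂ] ℂ) (k : ℕ) :
    ∃ (s : Finset (ℕ × ℕ)) (C : ℝ), 0 ≤ C ∧ ∀ (φ : 𝓢(V × W, ℂ)) (x : V),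
      ‖x‖ ^ k * ‖T (sliceCLM x φ)‖ ≤ C * s.sup (schwartzSeminormFamily ℂ (V × W) ℂ) φ := by
  obtain ⟨s, C, -, h⟩ := Seminorm.bound_of_continuous (schwartz_withSeminorms ℂ W ℂ)
    ((normSeminorm ℂ ℂ).comp T.toLinearMap) (continuous_norm.comp T.continuous)
  refine ⟨s.image fun m => (k + m.1, m.2), C, C.2, fun φ x => ?_⟩
  have h1 : ‖T (sliceCLM x φ)‖ ≤ C * s.sup (schwartzSeminormFamily ℂ W ℂ) (sliceCLM x φ) :=
    h (sliceCLM x φ)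
  have h2 : ‖x‖ ^ k * s.sup (schwartzSeminormFamily ℂ W ℂ) (sliceCLM x φ)
      ≤ (s.image fun m => (k + m.1, m.2)).sup (schwartzSeminormFamily ℂ (V × W) ℂ) φ := by
    have hp : ‖x‖ ^ k * s.sup (schwartzSeminormFamily ℂ W ℂ) (sliceCLM x φ)
        = s.sup (schwartzSeminormFamily ℂ W ℂ) (((‖x‖ ^ k : ℝ) : ℂ) • sliceCLM x φ) := by
      rw [map_smul_eq_mul, Complex.norm_real, Real.norm_of_nonneg (by positivity)]
    rw [hp]
    refine Seminorm.finset_sup_apply_le (apply_nonneg _ _) fun m hm => ?_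
    rw [map_smul_eq_mul, Complex.norm_real, Real.norm_of_nonneg (by positivity)]
    refine (seminorm_sliceCLM_le φ x k m.1 m.2).trans ?_
    have h3 : schwartzSeminormFamily ℂ (V × W) ℂ (k + m.1, m.2)
        ≤ (s.image fun m => (k + m.1, m.2)).sup (schwartzSeminormFamily ℂ (V × W) ℂ) :=
      Finset.le_sup (Finset.mem_image_of_mem (fun m : ℕ × ℕ => (k + m.1, m.2)) hm)
    exact h3 φ
  calc _ ≤ ‖x‖ ^ k * (C * s.sup (schwartzSeminormFamily ℂ W ℂ) (sliceCLM x φ)) := by gcongr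
    _ = C * (‖x‖ ^ k * s.sup (schwartzSeminormFamily ℂ W ℂ) (sliceCLM x φ)) := by ring
    _ ≤ _ := by gcongr

variable [FiniteDimensional ℝ V]

/-- Differentiation under the pairing with `T`. -/
theorem hasFDerivAt_slice (T : 𝓢(W, ℂ) →L[ℂ] ℂ) (φ : 𝓢(V × W, ℂ)) (x : V) :
    ∃ L : V →L[ℝ] ℂ, (∀ h, L h = T (sliceCLM x (∂_{((h, 0) : V × W)} φ))) ∧
      HasFDerivAt (fun x => T (sliceCLM x φ)) L x := by
  let L : V →ₗ[ℝ] ℂ :=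
    { toFun := fun h => T (sliceCLM x (∂_{((h, 0) : V × W)} φ))
      map_add' := fun a b => by
        have : ((a + b, 0) : V × W) = (a, 0) + (b, 0) := by simp
        rw [this, lineDerivOp_left_add, map_add, map_add]
      map_smul' := fun c a => by
        have : ((c • a, 0) : V × W) = c • (a, 0) := by simp
        rw [this, lineDerivOp_left_smul]
        have e : c • ∂_{((a, 0) : V × W)} φ = (c : ℂ) • ∂_{((a, 0) : V × W)} φ := by
          ext z; simp
        rw [e, map_smul, map_smul]; simp }
  refine ⟨LinearMap.toContinuousLinearMap L, fun h => rfl, ?_⟩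
  obtain ⟨s, C, hC, hT⟩ := slice_bound (V := V) T 0
  choose D hD0 hD using fun m : ℕ × ℕ => schwartz_taylor (V := V × W) m.2 ℂ φ m.1
  have hbd : ∀ h : V, ‖h‖ ≤ 1 →
      ‖T (sliceCLM (x + h) φ) - T (sliceCLM x φ) - L h‖ ≤ (C * ∑ m ∈ s, D m) * ‖h‖ ^ 2 := by
    intro h hh
    set ψ : 𝓢(V × W, ℂ) := compSubConstCLM ℂ (-(h, 0) : V × W) φ - φ - ∂_{((h, 0) : V × W)} φ
    have e : T (sliceCLM (x + h) φ) - T (sliceCLM x φ) - L h = T (sliceCLM x ψ) := by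
      have : sliceCLM (x + h) φ = sliceCLM x (compSubConstCLM ℂ (-(h, 0) : V × W) φ) := by
        ext y; simp [sliceCLM_apply]
      simp only [ψ, map_sub, this]
      rfl
    rw [e]
    have h1 := hT ψ x
    rw [pow_zero, one_mul] at h1
    refine h1.trans ?_
    rw [mul_assoc]
    gcongr
    have hn : ‖((h, 0) : V × W)‖ = ‖h‖ := by simp [Prod.norm_def]
    refine Seminorm.finset_sup_apply_le (mul_nonneg (Finset.sum_nonneg fun m _ => hD0 m) (sq_nonneg _)) fun m hm => ?_
    refine (SchwartzMap.seminorm_le_bound ℂ m.1 m.2 ψ (M := D m * ‖h‖ ^ 2)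
      (by have := hD0 m; positivity) fun z => ?_).trans ?_
    · have := hD m (h, 0) (hn.le.trans hh) z
      rw [hn] at this
      convert! this using 4
      funext y
      have e1 : y - -((h, 0) : V × W) = y + (h, 0) := sub_neg_eq_add _ _
      change φ (y - -((h, 0) : V × W)) - φ y - (∂_{((h, 0) : V × W)} φ) y = _
      rw [e1, lineDerivOp_apply_eq_fderiv]
    · gcongr
      exact Finset.single_le_sum (fun m _ => hD0 m) hm
  rw [hasFDerivAt_iff_isLittleO_nhds_zero]
  refine Asymptotics.IsBigO.trans_isLittleO (g := fun h : V => ‖h‖ ^ 2) ?_ ?_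
  · refine Asymptotics.IsBigO.of_bound (C * ∑ m ∈ s, D m) ?_
    filter_upwards [Metric.ball_mem_nhds (0 : V) one_pos] with h hh
    rw [Real.norm_of_nonneg (by positivity)]
    exact hbd h (by simpa using (mem_ball_zero_iff.1 hh).le)
  · exact Asymptotics.isLittleO_norm_pow_id one_lt_two

theorem contDiff_slice (T : 𝓢(W, ℂ) →L[ℂ] ℂ) (n : ℕ) :
    ∀ φ : 𝓢(V × W, ℂ), ContDiff ℝ n (fun x => T (sliceCLM x φ)) := by
  induction n with
  | zero =>
    intro φ
    refine contDiff_zero.2 (continuous_iff_continuousAt.2 fun x => ?_)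
    obtain ⟨L, -, hL⟩ := hasFDerivAt_slice T φ x
    exact hL.continuousAt
  | succ n ih =>
    intro φ
    choose L hL hd using hasFDerivAt_slice T φ
    have : ((n + 1 : ℕ) : WithTop ℕ∞) = n + 1 := by simp
    rw [this, contDiff_succ_iff_hasFDerivAt]
    refine ⟨L, ?_, hd⟩
    rw [contDiff_clm_apply_iff]
    intro h
    simp only [hL]
    exact ih _

theorem slice_decay (T : 𝓢(W, ℂ) →L[ℂ] ℂ) (k n : ℕ) :
    ∃ (s : Finset (ℕ × ℕ)) (C : ℝ), 0 ≤ C ∧ ∀ (φ : 𝓢(V × W, ℂ)) (x : V),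
      ‖x‖ ^ k * ‖iteratedFDeriv ℝ n (fun x => T (sliceCLM x φ)) x‖
        ≤ C * s.sup (schwartzSeminormFamily ℂ (V × W) ℂ) φ := by
  induction n with
  | zero => simpa only [norm_iteratedFDeriv_zero] using slice_bound T k
  | succ n ih =>
    obtain ⟨s, C, hC, H⟩ := ih
    let b := Module.finBasis ℝ V
    let c : Fin (Module.finrank ℝ V) → (V →L[ℝ] ℝ) :=
      fun i => LinearMap.toContinuousLinearMap (b.coord i)
    let B : Fin (Module.finrank ℝ V) → (ℂ →L[ℝ] (V →L[ℝ] ℂ)) :=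
      fun i => ContinuousLinearMap.smulRightL ℝ V ℂ (c i)
    let p := s.sup (schwartzSeminormFamily ℂ (V × W) ℂ)
    have hpc : Continuous p := by
      have hs : WithSeminorms (schwartzSeminormFamily ℂ (V × W) ℂ) :=
        schwartz_withSeminorms ℂ (V × W) ℂ
      refine Seminorm.continuous_of_le (q := ∑ i ∈ s, schwartzSeminormFamily ℂ (V × W) ℂ i) ?_
        (Seminorm.finset_sup_le_sum _ s)
      have e : (⇑(∑ i ∈ s, schwartzSeminormFamily ℂ (V × W) ℂ i) : 𝓢(V × W, ℂ) → ℝ)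
          = fun φ => ∑ i ∈ s, schwartzSeminormFamily ℂ (V × W) ℂ i φ := by
        ext φ; simp
      rw [e]
      exact continuous_finsetSum _ fun i _ => hs.continuous_seminorm i
    choose t D _ hD using fun i => Seminorm.bound_of_continuous
      (schwartz_withSeminorms ℂ (V × W) ℂ)
      (p.comp (lineDerivOpCLM ℂ 𝓢(V × W, ℂ) ((b i, 0) : V × W)).toLinearMap)
      (hpc.comp (lineDerivOpCLM ℂ 𝓢(V × W, ℂ) ((b i, 0) : V × W)).continuous)
    refine ⟨Finset.univ.biUnion t, ∑ i, ‖B i‖ * C * D i, by positivity, fun φ x => ?_⟩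
    have hfd : fderiv ℝ (fun x => T (sliceCLM x φ)) = fun x =>
        ∑ i, B i (T (sliceCLM x (∂_{((b i, 0) : V × W)} φ))) := by
      funext x
      obtain ⟨L, hL, hd⟩ := hasFDerivAt_slice T φ x
      rw [hd.fderiv]
      refine ContinuousLinearMap.coe_injective (b.ext fun j => ?_)
      have hc : ∀ i, c i (b j) = if j = i then 1 else 0 := fun i => by
        simp [c, Finsupp.single_apply]
      have hB : ∀ i (a : ℂ), B i a (b j) = (if j = i then a else 0) := fun i a => by
        have : B i a (b j) = c i (b j) • a := rfl
        rw [this, hc]; split_ifs <;> simp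
      change L (b j) = (∑ i, B i (T (sliceCLM x (∂_{((b i, 0) : V × W)} φ)))) (b j)
      rw [hL, sum_apply]
      simp [hB]
    rw [← norm_iteratedFDeriv_fderiv, hfd]
    have hcd : ∀ i, ContDiff ℝ n
        (fun x : V => B i (T (sliceCLM x (∂_{((b i, 0) : V × W)} φ)))) :=
      fun i => (B i).contDiff.comp (contDiff_slice T n _)
    rw [iteratedFDeriv_fun_sum_apply (fun i _ => (hcd i).contDiffAt)]
    have hterm : ∀ i, ‖x‖ ^ k * ‖iteratedFDeriv ℝ n
        (fun x : V => B i (T (sliceCLM x (∂_{((b i, 0) : V × W)} φ)))) x‖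
        ≤ ‖B i‖ * C * D i * (Finset.univ.biUnion t).sup (schwartzSeminormFamily ℂ (V × W) ℂ) φ := by
      intro i
      have h1 := (B i).norm_iteratedFDeriv_comp_left
        (contDiff_slice T n (∂_{((b i, 0) : V × W)} φ)).contDiffAt (x := x) le_rfl
      have h2 := H (∂_{((b i, 0) : V × W)} φ) x
      have h3 : s.sup (schwartzSeminormFamily ℂ (V × W) ℂ) (∂_{((b i, 0) : V × W)} φ)
          ≤ D i * (t i).sup (schwartzSeminormFamily ℂ (V × W) ℂ) φ := hD i φ
      have h4 : (t i).sup (schwartzSeminormFamily ℂ (V × W) ℂ)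
          ≤ (Finset.univ.biUnion t).sup (schwartzSeminormFamily ℂ (V × W) ℂ) :=
        Finset.sup_mono (Finset.subset_biUnion_of_mem t (Finset.mem_univ i))
      have h5 := h4 φ
      calc _ ≤ ‖x‖ ^ k * (‖B i‖ * ‖iteratedFDeriv ℝ n
              (fun x => T (sliceCLM x (∂_{((b i, 0) : V × W)} φ))) x‖) := by
            gcongr; exact h1
        _ = ‖B i‖ * (‖x‖ ^ k * ‖iteratedFDeriv ℝ n
              (fun x => T (sliceCLM x (∂_{((b i, 0) : V × W)} φ))) x‖) := by ring
        _ ≤ ‖B i‖ * (C * (D i *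
              (Finset.univ.biUnion t).sup (schwartzSeminormFamily ℂ (V × W) ℂ) φ)) := by
            refine mul_le_mul_of_nonneg_left (h2.trans ?_) (norm_nonneg (B i))
            refine mul_le_mul_of_nonneg_left (h3.trans ?_) hC
            exact mul_le_mul_of_nonneg_left h5 (D i).2
        _ = _ := by ring
    calc _ ≤ ‖x‖ ^ k * ∑ i, ‖iteratedFDeriv ℝ n
          (fun x : V => B i (T (sliceCLM x (∂_{((b i, 0) : V × W)} φ)))) x‖ := by
          gcongr; exact norm_sum_le _ _
      _ ≤ _ := by
          rw [Finset.mul_sum, Finset.sum_mul]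
          exact Finset.sum_le_sum fun i _ => hterm i
/-- The Schwartz function `x ↦ ⟨T, y ↦ φ (x, y)⟩`, depending continuously and linearly on `φ`. -/
noncomputable def partialPairing (T : 𝓢(W, ℂ) →L[ℂ] ℂ) : 𝓢(V × W, ℂ) →L[ℂ] 𝓢(V, ℂ) :=
  mkCLM (fun φ x => T (sliceCLM x φ)) (fun _ _ _ => by simp) (fun _ _ _ => by simp)
    (fun φ => contDiff_infty.2 fun n => contDiff_slice T n φ)
    (fun m => slice_decay T m.1 m.2)

theorem partialPairing_apply (T : 𝓢(W, ℂ) →L[ℂ] ℂ) (φ : 𝓢(V × W, ℂ)) (x : V) :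
    partialPairing T φ x = T (sliceCLM x φ) := rfl
end Slice

section Basics

open ComplexConjugate

/-- Real Euclidean space with coordinates indexed by `ι`. -/
abbrev RSp (ι : Type) [Fintype ι] : Type := EuclideanSpace ℝ ι

/-- Characters `t ↦ exp (2πi ξ·t)` have temperate growth, hence multiply Schwartz functions. -/
theorem hasTemperateGrowth_char {V : Type} [NormedAddCommGroup V] [InnerProductSpace ℝ V] (ξ : V) :
    Function.HasTemperateGrowth
      (fun t : V => Complex.exp (2 * Real.pi * Complex.I * (inner ℝ ξ t : ℝ))) := by
  have h1 : Function.HasTemperateGrowth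
      (fun r : ℝ => Complex.exp (2 * Real.pi * Complex.I * (r : ℂ))) := by
    refine ⟨(contDiff_const.mul Complex.ofRealCLM.contDiff).cexp, fun n => ⟨0, (2 * Real.pi) ^ n, fun r => ?_⟩⟩
    have h : ∀ n, iteratedDeriv n (fun r : ℝ => Complex.exp (2 * Real.pi * Complex.I * (r : ℂ)))
        = fun r : ℝ => (2 * Real.pi * Complex.I) ^ n *
            Complex.exp (2 * Real.pi * Complex.I * (r : ℂ)) := by
      intro n
      induction n with
      | zero => simp
      | succ n ih =>
        rw [iteratedDeriv_succ, ih]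
        funext r
        have hd : HasDerivAt (fun r : ℝ => 2 * Real.pi * Complex.I * (r : ℂ))
            (2 * Real.pi * Complex.I) r := by
          simpa using (Complex.ofRealCLM.hasDerivAt (x := r)).const_mul (2 * Real.pi * Complex.I)
        rw [(hd.cexp.const_mul _).deriv]
        ring
    rw [norm_iteratedFDeriv_eq_norm_iteratedDeriv, h, norm_mul]
    have : ‖Complex.exp (2 * Real.pi * Complex.I * (r : ℂ))‖ = 1 := by
      rw [show (2 * Real.pi * Complex.I * (r : ℂ)) = ((2 * Real.pi * r : ℝ) : ℂ) * Complex.I by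
        push_cast; ring]
      exact Complex.norm_exp_ofReal_mul_I _
    rw [this]
    simp [abs_of_pos Real.pi_pos]
  exact h1.comp (Function.hasTemperateGrowth_inner_right ξ)

/-- Pointwise complex conjugation on Schwartz functions. -/
noncomputable def schwartzConj {V : Type} [NormedAddCommGroup V] [NormedSpace ℝ V] :
    𝓢(V, ℂ) →SL[starRingEnd ℂ] 𝓢(V, ℂ) :=
  mkCLM (fun φ x => conj (φ x)) (fun _ _ _ => by simp) (fun _ _ _ => by simp)
    (fun φ => Complex.conjCLE.contDiff.comp (φ.smooth ⊤)) (fun m => by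
      refine ⟨{m}, 1, zero_le_one, fun φ x => ?_⟩
      have h : ‖iteratedFDeriv ℝ m.2 (fun x => conj (φ x)) x‖ = ‖iteratedFDeriv ℝ m.2 φ x‖ :=
        Complex.conjLIE.norm_iteratedFDeriv_comp_left φ x m.2
      rw [h, Finset.sup_singleton, one_mul]
      exact SchwartzMap.le_seminorm ℂ _ _ _ _)

theorem schwartzConj_apply {V : Type} [NormedAddCommGroup V] [NormedSpace ℝ V] (φ : 𝓢(V, ℂ))
    (x : V) : schwartzConj φ x = conj (φ x) := rfl

/-- The conjugate `T̄` of a tempered distribution: `⟨T̄, φ⟩ = conj ⟨T, φ̄⟩` (bilinear pairings). -/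
noncomputable def conjDistrib {V : Type} [NormedAddCommGroup V] [NormedSpace ℝ V] (T : 𝓢'(V, ℂ)) :
    𝓢'(V, ℂ) :=
  ContinuousLinearMap.toPointwiseConvergenceCLM _ _ _ _
    { toFun := fun φ => conj (T (schwartzConj φ))
      map_add' := fun φ ψ => by simp
      map_smul' := fun c φ => by simp [map_smulₛₗ]
      cont := Complex.continuous_conj.comp (T.continuous.comp schwartzConj.continuous) }

/-- The tensor product of tempered distributions:
`⟨S ⊗ T, φ⟩ = ⟨S, x ↦ ⟨T, y ↦ φ (x, y)⟩⟩`. -/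
noncomputable def tensorDistrib {ι κ : Type} [Fintype ι] [Fintype κ] (S : 𝓢'(RSp ι, ℂ))
    (T : 𝓢'(RSp κ, ℂ)) : 𝓢'(RSp (ι ⊕ κ), ℂ) :=
  ContinuousLinearMap.toPointwiseConvergenceCLM _ _ _ _
    { toFun := fun φ => S (partialPairing ⟨T.toLinearMap, T.continuous⟩
        (compCLMOfContinuousLinearEquiv ℂ (EuclideanSpace.sumEquivProd (𝕜 := ℝ)).symm φ))
      map_add' := fun φ ψ => by simp
      map_smul' := fun c φ => by simp
      cont := S.continuous.comp ((ContinuousLinearMap.continuous _).comp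
        (ContinuousLinearMap.continuous _)) }

end Basics

/-- `IsMetaplectic A U`: the operator `U` is a metaplectic operator `μ(A)` with projection the
symplectic matrix `A`, for one choice of the phase factor. The metaplectic group is the group
generated by the Fourier transform, the rescalings `φ ↦ √|det L| φ(L x)` and the multiplications by
chirps `exp (iπ C x·x)`, up to unimodular constants. The projections of the generators are those for
which the intertwining relation `μ(A) π(z) = c π(A z) μ(A)`, `|c| = 1`, holds, where
`π(x, ξ) φ (t) = exp (2πi ξ·t) φ(t - x)`. The operators are considered here on the Schwartz space,
which all of them map onto itself; they preserve the `L²` norm and so have unique extensions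
to `L²` and to tempered distributions, see `metaplecticExt`. -/
inductive IsMetaplectic {ι : Type} [Fintype ι] [DecidableEq ι] :
    Matrix (ι ⊕ ι) (ι ⊕ ι) ℝ → (𝓢(RSp ι, ℂ) ≃L[ℂ] 𝓢(RSp ι, ℂ)) → Prop
  | phase (c : ℂ) (hc : ‖c‖ = 1) (U : 𝓢(RSp ι, ℂ) ≃L[ℂ] 𝓢(RSp ι, ℂ))
      (hU : ∀ φ x, U φ x = c * φ x) : IsMetaplectic 1 U
  | fourier (U : 𝓢(RSp ι, ℂ) ≃L[ℂ] 𝓢(RSp ι, ℂ))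
      (hU : ∀ φ x, U φ x = FourierTransform.fourier (φ : RSp ι → ℂ) x) :
      IsMetaplectic (Matrix.fromBlocks 0 1 (-1) 0) U
  | dilation (L : Matrix ι ι ℝ) (hL : IsUnit L.det) (U : 𝓢(RSp ι, ℂ) ≃L[ℂ] 𝓢(RSp ι, ℂ))
      (hU : ∀ φ x, U φ x = (Real.sqrt |L.det| : ℂ) * φ (WithLp.toLp 2 (L.mulVec x.ofLp))) :
      IsMetaplectic (Matrix.fromBlocks L⁻¹ 0 0 L.transpose) U
  | chirp (C : Matrix ι ι ℝ) (hC : C.IsSymm) (U : 𝓢(RSp ι, ℂ) ≃L[ℂ] 𝓢(RSp ι, ℂ))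
      (hU : ∀ φ x, U φ x =
        Complex.exp (Complex.I * Real.pi * (dotProduct (C.mulVec x.ofLp) x.ofLp : ℝ)) * φ x) :
      IsMetaplectic (Matrix.fromBlocks 1 0 C 1) U
  | comp {A B : Matrix (ι ⊕ ι) (ι ⊕ ι) ℝ} {U V : 𝓢(RSp ι, ℂ) ≃L[ℂ] 𝓢(RSp ι, ℂ)}
      (hU : IsMetaplectic A U) (hV : IsMetaplectic B V) : IsMetaplectic (A * B) (V.trans U)
  | inv {A : Matrix (ι ⊕ ι) (ι ⊕ ι) ℝ} {U : 𝓢(RSp ι, ℂ) ≃L[ℂ] 𝓢(RSp ι, ℂ)}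
      (hU : IsMetaplectic A U) : IsMetaplectic A⁻¹ U.symm

section Wigner

variable {ι : Type} [Fintype ι]

/-- The extension of a metaplectic operator `U` to tempered distributions (in particular to `L²`):
`⟨U T, φ⟩ = ⟨T, U⁻¹ φ⟩` for the pairings that are conjugate-linear in the test function, which
extends `U` because `U` is `L²`-unitary. Tempered distributions in Mathlib are linear
functionals, whence the two conjugations. -/
noncomputable def metaplecticExt (U : 𝓢(RSp ι, ℂ) ≃L[ℂ] 𝓢(RSp ι, ℂ)) (T : 𝓢'(RSp ι, ℂ)) :
    𝓢'(RSp ι, ℂ) :=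
  ContinuousLinearMap.toPointwiseConvergenceCLM _ _ _ _
    { toFun := fun φ => T (schwartzConj (U.symm (schwartzConj φ)))
      map_add' := fun φ ψ => by simp
      map_smul' := fun c φ => by simp [map_smulₛₗ]
      cont := T.continuous.comp (schwartzConj.continuous.comp
        (U.symm.continuous.comp schwartzConj.continuous)) }

/-- The `A`-Wigner distribution `W_A(f, g) = μ(A) (f ⊗ ḡ)`, where `U = μ(A)`. -/
noncomputable def wignerDistrib (U : 𝓢(RSp (ι ⊕ ι), ℂ) ≃L[ℂ] 𝓢(RSp (ι ⊕ ι), ℂ))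
    (f g : 𝓢'(RSp ι, ℂ)) : 𝓢'(RSp (ι ⊕ ι), ℂ) :=
  metaplecticExt U (tensorDistrib f (conjDistrib g))

/-- The position component `x` of `z = (x, ξ)`. -/
noncomputable def posPart (z : RSp (ι ⊕ ι)) : RSp ι := (EuclideanSpace.sumEquivProd (𝕜 := ℝ) z).1
/-- The frequency component `ξ` of `z = (x, ξ)`. -/
noncomputable def freqPart (z : RSp (ι ⊕ ι)) : RSp ι := (EuclideanSpace.sumEquivProd (𝕜 := ℝ) z).2

/-- The time-frequency shift `π(z) f (t) = exp (2πi ξ·t) f(t - x)`, `z = (x, ξ)`. -/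
noncomputable def tfShift (z : RSp (ι ⊕ ι)) (f : RSp ι → ℂ) (t : RSp ι) : ℂ :=
  Complex.exp (2 * Real.pi * Complex.I * (inner ℝ (freqPart z) t : ℝ)) * f (t - posPart z)

theorem memLp_tfShift (z : RSp (ι ⊕ ι)) {f : RSp ι → ℂ} (hf : MemLp f 2 volume) :
    MemLp (tfShift z f) 2 volume := by
  have h1 : MemLp (fun t => f (t - posPart z)) 2 volume :=
    hf.comp_measurePreserving (measurePreserving_sub_right volume (posPart z))
  refine (memLp_congr_norm ?_ h1.1 (ae_of_all _ fun t => ?_)).2 h1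
  · exact ((hasTemperateGrowth_char (freqPart z)).1.continuous.aestronglyMeasurable).mul h1.1
  · rw [tfShift, norm_mul, show (2 * Real.pi * Complex.I * (inner ℝ (freqPart z) t : ℝ) : ℂ)
      = ((2 * Real.pi * inner ℝ (freqPart z) t : ℝ) : ℂ) * Complex.I by push_cast; ring,
      Complex.norm_exp_ofReal_mul_I, one_mul]

/-- The time-frequency shift as an operator on the Schwartz space. -/
noncomputable def tfShiftSchwartz (z : RSp (ι ⊕ ι)) : 𝓢(RSp ι, ℂ) →L[ℂ] 𝓢(RSp ι, ℂ) :=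
  (smulLeftCLM ℂ fun t => Complex.exp (2 * Real.pi * Complex.I * (inner ℝ (freqPart z) t : ℝ))) ∘L
    compSubConstCLM ℂ (posPart z)

theorem tfShiftSchwartz_apply (z : RSp (ι ⊕ ι)) (φ : 𝓢(RSp ι, ℂ)) (t : RSp ι) :
    tfShiftSchwartz z φ t = tfShift z φ t := by
  simp [tfShiftSchwartz, tfShift, hasTemperateGrowth_char]

/-- The short-time Fourier transform `V_g f (x, ξ) = ⟨f, π(x, ξ) g⟩`, that is
`∫ f(y) conj (g(y - x)) exp (-2πi y·ξ) dy`, of a tempered distribution `f`. -/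
noncomputable def stft (g : 𝓢(RSp ι, ℂ)) (f : 𝓢'(RSp ι, ℂ)) (z : RSp (ι ⊕ ι)) : ℂ :=
  f (schwartzConj (tfShiftSchwartz z g))

/-- The weight `v_s(z) = (1 + |z|²)^(s/2)`. -/
noncomputable def weight (s : ℝ) (z : RSp ι) : ℝ := (1 + ‖z‖ ^ 2) ^ (s / 2)

/-- The modulation space `M^p_{v_s}`, measured with the window `g`. -/
def modulationSpace (g : 𝓢(RSp ι, ℂ)) (p : ℝ≥0∞) (s : ℝ) : Set 𝓢'(RSp ι, ℂ) :=
  {f | MemLp (fun z => (weight s z : ℂ) * stft g f z) p volume}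

/-- The weighted space `L^p_{v_s}`, `1 ≤ p ≤ ∞`, as a set of tempered distributions: those given by
integration against a measurable function `F` such that `v_s F` is in `L^p`. -/
def weightedLp (p : ℝ≥0∞) (s : ℝ) : Set 𝓢'(RSp ι, ℂ) :=
  {T | ∃ F : RSp ι → ℂ, MemLp (fun z => (weight s z : ℂ) * F z) p volume ∧
    ∀ φ : 𝓢(RSp ι, ℂ), T φ = ∫ z, φ z * F z}

variable [DecidableEq ι]

/-- `W_A` is shift-invertible, where `U = μ(A)`: for some invertible matrix `E`, all `f, g` in `L²`
and all `w`, the functions `F = W_A(π(w) f, g)` and `G = W_A(f, g)`, which are in `L²`, satisfy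
`|F(z)| = |G(z - E w)|` for almost every `z`. -/
def IsShiftInvertible (U : 𝓢(RSp (ι ⊕ ι), ℂ) ≃L[ℂ] 𝓢(RSp (ι ⊕ ι), ℂ)) : Prop :=
  ∃ E : Matrix (ι ⊕ ι) (ι ⊕ ι) ℝ, IsUnit E.det ∧
    ∀ (f g : RSp ι → ℂ) (hf : MemLp f 2 volume) (hg : MemLp g 2 volume) (w : RSp (ι ⊕ ι)),
      ∃ F G : Lp ℂ 2 (volume : Measure (RSp (ι ⊕ ι))),
        Lp.toTemperedDistribution F = wignerDistrib U
          (Lp.toTemperedDistribution (memLp_tfShift w hf).toLp)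
          (Lp.toTemperedDistribution hg.toLp) ∧
        Lp.toTemperedDistribution G = wignerDistrib U
          (Lp.toTemperedDistribution hf.toLp) (Lp.toTemperedDistribution hg.toLp) ∧
        ∀ᵐ z, ‖F z‖ = ‖G (z - WithLp.toLp 2 (E.mulVec w.ofLp))‖
end Wigner

end TimeFreq

open TimeFreq

/-!
The short-time Fourier transform of a distribution `T` with window `h̄` is `(x, ξ) ↦ T (atom h x ξ)`.
The two implications are proved separately.

*From `f` to `W_A f`.* Metaplectic operators intertwine time-frequency shifts
(`IsMetaplectic.tfShift_comm`). Hence the short-time Fourier transform of `W_A f` with the window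
`W_A g` is, up to a phase and the linear change of variables `wignerPhaseEquiv`, the product
`V_g f (w₁) · conj (V_g f (w₂))` (`norm_wignerDistrib_atom`). As `v_s` is submultiplicative up to
constants, `f ∈ M^p_{v_s}` implies that `v_s(x)` times this transform is in `L^p` of the doubled phase
space (`memLp_weight_of_le_mul`), and it remains to see that a distribution `T` with this property is a
function in `L^p_{v_s}`, for `1 ≤ p ≤ 2` (`exists_memLp_weight_of_stft`). Without the weight `T` is an
`L²` function `F`: by Plancherel and interpolation, the transform of a test function `φ` has
`L^{p'}` norm at most a constant times `‖φ‖_2`, because `p' ≥ 2`. In the same way, for fixed `x`, the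
piece `|h(· - x)|² F` has `L²` norm at most a constant times the `L^p` norm of `T (atom h x ·)`. One
more factor `h(· - x)` and Hölder's inequality turn this into an `L^p` bound, and integrating its
`p`-th power over `x`, with the weight, gives the claim.

*From `W_A f` to `f`.* Let `F` be the function `W_A f`. Pairing `W_A f` with the conjugate of
`W_A(π(w) g, γ)` gives `V_g f (w) · conj ⟨f, γ⟩`, so that, by shift-invertibility,
`|V_g f (w)| |⟨f, γ⟩| ≤ ∫ |F(z)| |W_A(g, γ)(z - E w)| dz` (`enorm_stft_mul_le`). Choosing `γ` with
`⟨f, γ⟩ ≠ 0` and using a weighted Young inequality (`lintegral_weight_correlation_lt_top`), with the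
Schwartz function `W_A(g, γ)` in `L^1_{v_s}`, one gets `v_s V_g f ∈ L^p`.

The analytic tool behind both is a Fubini theorem for tempered distributions,
`apply_eq_integral_slice`: a distribution can be moved under an integral `∫ Φ(x, ·) dx` of Schwartz
functions. It holds because a continuous functional on the Schwartz space factors through a Banach
space of bounded continuous functions, where the integral is a Bochner integral.
-/

namespace TimeFreq

/-! ### Tensor products of Schwartz functions -/

section Tensor
variable {V W : Type} [NormedAddCommGroup V] [NormedSpace ℝ V]
  [NormedAddCommGroup W] [NormedSpace ℝ W]

theorem norm_iteratedFDeriv_comp_clm_le {X Y : Type} [NormedAddCommGroup X] [NormedSpace ℝ X]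
    [NormedAddCommGroup Y] [NormedSpace ℝ Y] (φ : 𝓢(Y, ℂ)) (L : X →L[ℝ] Y) (hL : ‖L‖ ≤ 1)
    (n : ℕ) (x : X) : ‖iteratedFDeriv ℝ n (fun x => φ (L x)) x‖ ≤ ‖iteratedFDeriv ℝ n φ (L x)‖ := by
  have h := L.iteratedFDeriv_comp_right (n := ∞) (φ.smooth ⊤) x (i := n) (by exact_mod_cast le_top)
  change ‖iteratedFDeriv ℝ n (φ ∘ L) x‖ ≤ _
  rw [h]
  refine (ContinuousMultilinearMap.norm_compContinuousLinearMap_le _ _).trans ?_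
  exact mul_le_of_le_one_right (norm_nonneg _)
    (Finset.prod_le_one (fun _ _ => norm_nonneg _) fun _ _ => hL)

/-- The tensor product `(x, y) ↦ φ x * ψ y` of two Schwartz functions. -/
noncomputable def schwartzTensor (φ : 𝓢(V, ℂ)) (ψ : 𝓢(W, ℂ)) : 𝓢(V × W, ℂ) where
  toFun z := φ z.1 * ψ z.2
  smooth' := ((φ.smooth ⊤).comp contDiff_fst).mul ((ψ.smooth ⊤).comp contDiff_snd)
  decay' k n := by
    set P := ((Finset.Iic (k, n)).sup fun m => SchwartzMap.seminorm ℝ m.1 m.2) φ with hP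
    set Q := ((Finset.Iic (k, n)).sup fun m => SchwartzMap.seminorm ℝ m.1 m.2) ψ with hQ
    refine ⟨∑ i ∈ Finset.range (n + 1), (n.choose i : ℝ) * ((2 ^ k * P) * (2 ^ k * Q)),
      fun z => ?_⟩
    have h1 := norm_iteratedFDeriv_mul_le (n := n) (N := ∞)
      ((φ.smooth ⊤).comp (contDiff_fst (E := V) (F := W)))
      ((ψ.smooth ⊤).comp (contDiff_snd (E := V) (F := W))) z (by exact_mod_cast le_top)
    have hz : ‖z‖ ^ k ≤ (1 + ‖z.1‖) ^ k * (1 + ‖z.2‖) ^ k := by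
      rw [← mul_pow]
      gcongr
      have h1 := norm_nonneg z.1
      have h2 := norm_nonneg z.2
      rw [Prod.norm_def]
      refine max_le ?_ ?_ <;> nlinarith
    refine (mul_le_mul_of_nonneg_left h1 (by positivity)).trans ?_
    rw [Finset.mul_sum]
    refine Finset.sum_le_sum fun i hi => ?_
    have hin : i ≤ n := by simpa [Nat.lt_succ_iff] using hi
    have a1 := norm_iteratedFDeriv_comp_clm_le φ (ContinuousLinearMap.fst ℝ V W)
      (ContinuousLinearMap.norm_fst_le ..) i z
    have a2 := norm_iteratedFDeriv_comp_clm_le ψ (ContinuousLinearMap.snd ℝ V W)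
      (ContinuousLinearMap.norm_snd_le ..) (n - i) z
    have b1 : (1 + ‖z.1‖) ^ k * ‖iteratedFDeriv ℝ i φ z.1‖ ≤ 2 ^ k * P :=
      one_add_le_sup_seminorm_apply (𝕜 := ℝ) (m := (k, n)) le_rfl hin φ z.1
    have b2 : (1 + ‖z.2‖) ^ k * ‖iteratedFDeriv ℝ (n - i) ψ z.2‖ ≤ 2 ^ k * Q :=
      one_add_le_sup_seminorm_apply (𝕜 := ℝ) (m := (k, n)) le_rfl (Nat.sub_le _ _) ψ z.2
    calc _ ≤ ((1 + ‖z.1‖) ^ k * (1 + ‖z.2‖) ^ k) * ((n.choose i : ℝ) *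
          ‖iteratedFDeriv ℝ i φ z.1‖ * ‖iteratedFDeriv ℝ (n - i) ψ z.2‖) := by
          gcongr
          · exact a1
          · exact a2
      _ = (n.choose i : ℝ) * (((1 + ‖z.1‖) ^ k * ‖iteratedFDeriv ℝ i φ z.1‖) *
          ((1 + ‖z.2‖) ^ k * ‖iteratedFDeriv ℝ (n - i) ψ z.2‖)) := by ring
      _ ≤ _ := by gcongr

theorem schwartzTensor_apply (φ : 𝓢(V, ℂ)) (ψ : 𝓢(W, ℂ)) (z : V × W) :
    schwartzTensor φ ψ z = φ z.1 * ψ z.2 := rfl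

end Tensor

/-! ### Fubini's theorem for tempered distributions -/

section Fubini

/-- Bounded continuous functions into a normed space. The abbreviation fixes the metric on the target
to be the one of the norm. -/
abbrev NormedBCF (W E : Type) [TopologicalSpace W] [NormedAddCommGroup E] : Type :=
  BoundedContinuousFunction W E

variable {V W : Type} [NormedAddCommGroup V] [NormedSpace ℝ V]
  [NormedAddCommGroup W] [NormedSpace ℝ W]

/-- The map `φ ↦ ‖y‖ ^ k • D^n φ y` into the bounded continuous functions, whose norm is the Schwartz
seminorm of index `(k, n)`. -/
noncomputable def weightedDerivBCF (k n : ℕ) :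
    𝓢(W, ℂ) →ₗ[ℂ] NormedBCF W (W [×n]→L[ℝ] ℂ) where
  toFun φ := BoundedContinuousFunction.ofNormedAddCommGroup
    (fun y => (‖y‖ ^ k : ℝ) • iteratedFDeriv ℝ n φ y)
    ((continuous_norm.pow k).smul ((φ.smooth n).continuous_iteratedFDeriv le_rfl))
    (SchwartzMap.seminorm ℂ k n φ) (fun y => by
      rw [norm_smul, Real.norm_of_nonneg (by positivity)]
      exact SchwartzMap.le_seminorm ℂ k n φ y)
  map_add' φ ψ := by
    ext1 y
    have : iteratedFDeriv ℝ n (φ + ψ : 𝓢(W, ℂ)) y = iteratedFDeriv ℝ n φ y + iteratedFDeriv ℝ n ψ y :=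
      iteratedFDeriv_add_apply (φ.contDiffAt n) (ψ.contDiffAt n)
    simp only [BoundedContinuousFunction.coe_ofNormedAddCommGroup, this, smul_add]
    rfl
  map_smul' c φ := by
    ext1 y
    have : iteratedFDeriv ℝ n (c • φ : 𝓢(W, ℂ)) y = c • iteratedFDeriv ℝ n φ y :=
      iteratedFDeriv_const_smul_apply (φ.contDiffAt n)
    simp only [BoundedContinuousFunction.coe_ofNormedAddCommGroup, this]
    exact smul_comm _ _ _

theorem weightedDerivBCF_apply (k n : ℕ) (φ : 𝓢(W, ℂ)) (y : W) :
    weightedDerivBCF k n φ y = (‖y‖ ^ k : ℝ) • iteratedFDeriv ℝ n φ y := rfl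

theorem norm_weightedDerivBCF (k n : ℕ) (φ : 𝓢(W, ℂ)) :
    ‖weightedDerivBCF k n φ‖ = SchwartzMap.seminorm ℂ k n φ := by
  refine le_antisymm (BoundedContinuousFunction.norm_ofNormedAddCommGroup_le
    _ (apply_nonneg _ _) fun y => ?_) ?_
  · rw [norm_smul, Real.norm_of_nonneg (by positivity)]
    exact SchwartzMap.le_seminorm ℂ k n φ y
  refine SchwartzMap.seminorm_le_bound ℂ k n φ (norm_nonneg _) fun y => ?_
  have := (weightedDerivBCF k n φ).norm_coe_le_norm y
  rwa [weightedDerivBCF_apply, norm_smul, Real.norm_of_nonneg (by positivity)] at this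

/-- The map `φ ↦ (weightedDerivBCF k n φ)` for finitely many indices `(k, n)` jointly, with values in
a Banach space. -/
noncomputable def schwartzToBanach (s : Finset (ℕ × ℕ)) :
    𝓢(W, ℂ) →ₗ[ℂ] ((m : s) → NormedBCF W (W [×m.1.2]→L[ℝ] ℂ)) :=
  LinearMap.pi fun m => weightedDerivBCF m.1.1 m.1.2

/-- A tempered distribution factors through a Banach space of bounded continuous functions: it is
bounded by finitely many Schwartz seminorms, hence defined on the range of `schwartzToBanach s`, and
extends by the Hahn–Banach theorem. Bochner integrals can be moved through this factorization. -/
theorem exists_factor_schwartzToBanach (T : 𝓢(W, ℂ) →L[ℂ] ℂ) :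
    ∃ (s : Finset (ℕ × ℕ))
      (l : ((m : s) → NormedBCF W (W [×m.1.2]→L[ℝ] ℂ)) →L[ℂ] ℂ),
      ∀ φ, T φ = l (schwartzToBanach s φ) := by
  obtain ⟨s₀, C, -, h⟩ := Seminorm.bound_of_continuous (schwartz_withSeminorms ℂ W ℂ)
    ((normSeminorm ℂ ℂ).comp T.toLinearMap) (continuous_norm.comp T.continuous)
  -- the index `(0, 0)`, that is the sup norm, is added to make `schwartzToBanach s` injective
  set s := insert (0, 0) s₀ with hs
  have hle : ∀ φ, ‖T φ‖ ≤ C * ‖schwartzToBanach s φ‖ := by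
    intro φ
    have h1 : ‖T φ‖ ≤ C * s₀.sup (schwartzSeminormFamily ℂ W ℂ) φ := h φ
    refine h1.trans ?_
    gcongr
    refine Seminorm.finset_sup_apply_le (norm_nonneg _) fun m hm => ?_
    have h2 := norm_le_pi_norm (schwartzToBanach s φ) ⟨m, Finset.mem_insert_of_mem hm⟩
    exact (norm_weightedDerivBCF m.1 m.2 φ).symm.trans_le h2
  have hinj : Function.Injective (schwartzToBanach (W := W) s) := by
    rw [injective_iff_map_eq_zero]
    intro φ hφ
    have h2 : weightedDerivBCF 0 0 φ = 0 :=
      congrFun hφ (⟨(0, 0), Finset.mem_insert_self _ _⟩ : s)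
    have h3 : SchwartzMap.seminorm ℂ 0 0 φ = 0 := by
      rw [← norm_weightedDerivBCF, h2, norm_zero]
    ext y
    have := SchwartzMap.norm_le_seminorm ℂ φ y
    rw [h3] at this
    simpa using this
  let e := LinearEquiv.ofInjective (schwartzToBanach (W := W) s) hinj
  let l₀ : (LinearMap.range (schwartzToBanach (W := W) s)) →L[ℂ] ℂ :=
    LinearMap.mkContinuous (T.toLinearMap ∘ₗ e.symm.toLinearMap) C (fun u => by
      obtain ⟨φ, rfl⟩ := e.surjective u
      change ‖T (e.symm (e φ))‖ ≤ _
      rw [e.symm_apply_apply]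
      exact hle φ)
  obtain ⟨l, hl, -⟩ := exists_extension_norm_eq _ l₀
  refine ⟨s, l, fun φ => ?_⟩
  have := hl (e φ)
  simp only [l₀, LinearMap.mkContinuous_apply, LinearMap.comp_apply, LinearEquiv.coe_coe,
    LinearEquiv.symm_apply_apply] at this
  exact this.symm

theorem lineDerivOp_slice (v : W) (x : V) (Φ : 𝓢(V × W, ℂ)) :
    ∂_{v} (sliceCLM x Φ) = sliceCLM x (∂_{((0, v) : V × W)} Φ) := by
  ext y
  rw [lineDerivOp_apply_eq_fderiv, sliceCLM_apply, lineDerivOp_apply_eq_fderiv]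
  have h : HasFDerivAt (fun y : W => Φ (x, y))
      ((fderiv ℝ Φ (x, y)).comp (ContinuousLinearMap.inr ℝ V W)) y :=
    (Φ.differentiableAt.hasFDerivAt).comp y (hasFDerivAt_prodMk_right x y)
  change fderiv ℝ (fun y : W => Φ (x, y)) y v = _
  rw [h.fderiv]
  simp

/-- The slices of a Schwartz function depend continuously on the slicing point in every Schwartz
seminorm, by the Taylor estimate `schwartz_taylor`. -/
theorem continuous_weightedDerivBCF_slice (k n : ℕ) (Φ : 𝓢(V × W, ℂ)) :
    Continuous fun x : V => weightedDerivBCF k n (sliceCLM x Φ) := by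
  obtain ⟨C, hC, H⟩ := schwartz_taylor (V := V × W) n ℂ Φ k
  set D := SchwartzMap.seminorm ℂ k n (fderivCLM ℂ (V × W) ℂ Φ) with hD
  have key : ∀ x h : V, ‖h‖ ≤ 1 → ‖weightedDerivBCF k n (sliceCLM (x + h) Φ)
      - weightedDerivBCF k n (sliceCLM x Φ)‖ ≤ (C + D) * ‖h‖ := by
    intro x h hh
    have hn : ‖((h, 0) : V × W)‖ = ‖h‖ := by simp [Prod.norm_def]
    set Ψ : 𝓢(V × W, ℂ) := compSubConstCLM ℂ (-(h, 0) : V × W) Φ - Φ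
    have e1 : sliceCLM (x + h) Φ - sliceCLM x Φ = sliceCLM x Ψ := by
      ext y
      simp [sliceCLM_apply, Ψ]
    rw [← map_sub, e1, norm_weightedDerivBCF]
    have h1 := seminorm_sliceCLM_le Ψ x 0 k n
    rw [pow_zero, one_mul, zero_add] at h1
    refine h1.trans ?_
    have e2 : Ψ = (Ψ - ∂_{((h, 0) : V × W)} Φ) + ∂_{((h, 0) : V × W)} Φ := by abel
    rw [e2]
    refine (map_add_le_add _ _ _).trans ?_
    rw [add_mul]
    refine add_le_add ?_ ?_
    · refine SchwartzMap.seminorm_le_bound ℂ k n _ (by positivity) fun z => ?_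
      have := H (h, 0) (hn.le.trans hh) z
      rw [hn] at this
      refine le_trans (le_of_eq ?_) (this.trans ?_)
      · congr 3
        funext y
        have e1 : y - -((h, 0) : V × W) = y + (h, 0) := sub_neg_eq_add _ _
        change Φ (y - -((h, 0) : V × W)) - Φ y - (∂_{((h, 0) : V × W)} Φ) y = _
        rw [e1, lineDerivOp_apply_eq_fderiv]
      · gcongr
        rw [sq]
        exact mul_le_of_le_one_right (norm_nonneg _) hh
    · refine SchwartzMap.seminorm_le_bound ℂ k n _ (by positivity) fun z => ?_
      have e3 : (⇑(∂_{((h, 0) : V × W)} Φ : 𝓢(V × W, ℂ)) : V × W → ℂ)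
          = (ContinuousLinearMap.apply ℝ ℂ ((h, 0) : V × W)) ∘ (fderivCLM ℂ (V × W) ℂ Φ) := by
        funext z; rfl
      have h3 := (ContinuousLinearMap.apply ℝ ℂ ((h, 0) : V × W)).norm_iteratedFDeriv_comp_left
        ((fderivCLM ℂ (V × W) ℂ Φ).contDiffAt n (x := z)) le_rfl
      have h4 : ‖ContinuousLinearMap.apply ℝ ℂ ((h, 0) : V × W)‖ ≤ ‖h‖ := by
        refine ContinuousLinearMap.opNorm_le_bound _ (norm_nonneg _) fun A => ?_
        rw [mul_comm, ← hn]
        exact A.le_opNorm _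
      rw [← e3] at h3
      calc _ ≤ ‖z‖ ^ k * (‖h‖ * ‖iteratedFDeriv ℝ n (fderivCLM ℂ (V × W) ℂ Φ) z‖) := by
            gcongr
            exact h3.trans (by gcongr)
        _ = (‖z‖ ^ k * ‖iteratedFDeriv ℝ n (fderivCLM ℂ (V × W) ℂ Φ) z‖) * ‖h‖ := by ring
        _ ≤ _ := by
            gcongr
            exact SchwartzMap.le_seminorm ℂ k n _ z
  have hD0 : 0 ≤ D := apply_nonneg _ _
  rw [continuous_iff_continuousAt]
  intro x
  rw [Metric.continuousAt_iff]
  intro ε hε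
  refine ⟨min 1 (ε / (C + D + 1)), by positivity, fun {y} hy => ?_⟩
  have hy1 : ‖y - x‖ < 1 := (dist_eq_norm y x ▸ hy).trans_le (min_le_left _ _)
  have hy2 : ‖y - x‖ < ε / (C + D + 1) := (dist_eq_norm y x ▸ hy).trans_le (min_le_right _ _)
  have := key x (y - x) hy1.le
  rw [add_sub_cancel] at this
  rw [dist_eq_norm]
  refine this.trans_lt ?_
  rw [lt_div_iff₀ (by positivity)] at hy2
  nlinarith [norm_nonneg (y - x)]

variable [FiniteDimensional ℝ V] [FiniteDimensional ℝ W] [MeasurableSpace V] [BorelSpace V]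
  (μ : Measure V) [μ.IsAddHaarMeasure]

/-- Differentiation under the integral sign, as a case of `hasFDerivAt_slice` for the distribution
`∫ · ∂μ`. -/
theorem lineDerivOp_eq_integral (Φ : 𝓢(V × W, ℂ)) (ψ : 𝓢(W, ℂ))
    (h : ∀ y, ψ y = ∫ x, Φ (x, y) ∂μ) (v : W) (y : W) :
    (∂_{v} ψ) y = ∫ x, (∂_{((0, v) : V × W)} Φ) (x, y) ∂μ := by
  let S := compCLMOfContinuousLinearEquiv ℂ (F := ℂ) (ContinuousLinearEquiv.prodComm ℝ W V)
  obtain ⟨L, hL, hd⟩ := hasFDerivAt_slice (integralCLM ℂ μ) (S Φ) y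
  have e : (ψ : W → ℂ) = fun y => integralCLM ℂ μ (sliceCLM y (S Φ)) := by
    funext y
    rw [h, integralCLM_apply]; rfl
  rw [lineDerivOp_apply_eq_fderiv, e, hd.fderiv, hL, integralCLM_apply]
  refine integral_congr_ae (ae_of_all _ fun x => ?_)
  simp only [sliceCLM_apply, S]
  rw [lineDerivOp_compCLMOfContinuousLinearEquiv]
  rfl

theorem iteratedLineDerivOp_eq_integral (n : ℕ) : ∀ (Φ : 𝓢(V × W, ℂ)) (ψ : 𝓢(W, ℂ))
    (_ : ∀ y, ψ y = ∫ x, Φ (x, y) ∂μ) (v : Fin n → W) (y : W),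
    (∂^{v} ψ) y = ∫ x, (∂^{v} (sliceCLM x Φ)) y ∂μ := by
  induction n with
  | zero =>
    intro Φ ψ h v y
    simpa [sliceCLM_apply] using h y
  | succ n ih =>
    intro Φ ψ h v y
    rw [iteratedLineDerivOp_succ_right]
    simp only [iteratedLineDerivOp_succ_right, lineDerivOp_slice]
    exact ih _ _ (fun y => lineDerivOp_eq_integral μ Φ ψ h _ y) _ y

/-- Fubini's theorem for a tempered distribution: `T` may be applied under an integral of
Schwartz functions depending on a Schwartz parameter. -/
theorem apply_eq_integral_slice (T : 𝓢(W, ℂ) →L[ℂ] ℂ) (Φ : 𝓢(V × W, ℂ)) (ψ : 𝓢(W, ℂ))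
    (h : ∀ y, ψ y = ∫ x, Φ (x, y) ∂μ) : T ψ = ∫ x, T (sliceCLM x Φ) ∂μ := by
  obtain ⟨s, l, hl⟩ := exists_factor_schwartzToBanach T
  have hint : ∀ k n, Integrable (fun x : V => weightedDerivBCF k n (sliceCLM x Φ)) μ := by
    intro k n
    have hc := (continuous_weightedDerivBCF_slice k n Φ).aestronglyMeasurable (μ := μ)
    rw [← integrable_norm_iff hc]
    suffices h0 : Integrable (fun x : V => ‖x‖ ^ 0 * ‖weightedDerivBCF k n (sliceCLM x Φ)‖) μ by
      simpa only [pow_zero, one_mul] using h0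
    refine integrable_of_le_of_pow_mul_le (μ := μ) (k := 0) (C₁ := SchwartzMap.seminorm ℂ k n Φ)
      (C₂ := SchwartzMap.seminorm ℂ (μ.integrablePower + k) n Φ) (fun x => ?_) (fun x => ?_)
      hc
    · rw [norm_weightedDerivBCF]
      simpa using seminorm_sliceCLM_le Φ x 0 k n
    · rw [norm_weightedDerivBCF, zero_add]
      exact seminorm_sliceCLM_le Φ x _ k n
  have hint' : Integrable (fun x : V => schwartzToBanach s (sliceCLM x Φ)) μ :=
    Integrable.of_eval fun m => hint m.1.1 m.1.2
  have key : ∫ x, schwartzToBanach s (sliceCLM x Φ) ∂μ = schwartzToBanach s ψ := by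
    funext m
    rw [eval_integral (fun m => hint m.1.1 m.1.2)]
    change ∫ x, weightedDerivBCF m.1.1 m.1.2 (sliceCLM x Φ) ∂μ = weightedDerivBCF m.1.1 m.1.2 ψ
    ext y v
    let E : (NormedBCF W (W [×m.1.2]→L[ℝ] ℂ)) →L[ℝ] ℂ :=
      (ContinuousMultilinearMap.apply ℝ (fun _ : Fin m.1.2 => W) ℂ v) ∘L
        (BoundedContinuousFunction.evalCLM ℝ y)
    have hE : ∀ u, u y v = E u := fun u => rfl
    rw [hE, hE, ← E.integral_comp_comm (hint _ _)]
    have hEv : ∀ φ : 𝓢(W, ℂ), E (weightedDerivBCF m.1.1 m.1.2 φ)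
        = (‖y‖ ^ m.1.1 : ℝ) • (∂^{v} φ) y := fun φ => by
      rw [iteratedLineDerivOp_eq_iteratedFDeriv]; rfl
    simp only [hEv]
    rw [integral_smul, iteratedLineDerivOp_eq_integral μ _ Φ ψ h]
  rw [hl, ← key, ← l.integral_comp_comm hint']
  simp only [hl]

end Fubini

/-! ### Time-frequency atoms and their pairing with distributions -/

section Gabor

theorem hasTemperateGrowth_cexp {E : Type} [NormedAddCommGroup E] [NormedSpace ℝ E] {r : E → ℝ}
    (hr : Function.HasTemperateGrowth r) :
    Function.HasTemperateGrowth fun x => Complex.exp (2 * Real.pi * Complex.I * (r x : ℝ)) := by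
  have h := (hasTemperateGrowth_char (1 : ℝ)).comp hr
  have e : (fun x => Complex.exp (2 * Real.pi * Complex.I * (r x : ℝ)))
      = (fun t : ℝ => Complex.exp (2 * Real.pi * Complex.I * (inner ℝ (1 : ℝ) t : ℝ))) ∘ r := by
    funext x
    simp
  rwa [e]

theorem norm_cexp_two_pi_I (r : ℝ) : ‖Complex.exp (2 * Real.pi * Complex.I * (r : ℂ))‖ = 1 := by
  rw [show (2 * Real.pi * Complex.I * (r : ℂ)) = ((2 * Real.pi * r : ℝ) : ℂ) * Complex.I by
    push_cast; ring]
  exact Complex.norm_exp_ofReal_mul_I _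

variable {V : Type} [NormedAddCommGroup V] [InnerProductSpace ℝ V]

/-- The atom `t ↦ exp (-2πi ξ·t) h(t - x)`, the conjugate of the time-frequency shift by `(x, ξ)` of
the window `g = h̄`. A tempered distribution `T` has the short-time Fourier transform
`(x, ξ) ↦ T (atom h x ξ)`. -/
noncomputable def atom (h : 𝓢(V, ℂ)) (x ξ : V) : 𝓢(V, ℂ) :=
  smulLeftCLM ℂ (fun t => Complex.exp (2 * Real.pi * Complex.I * (inner ℝ (-ξ) t : ℝ)))
    (compSubConstCLM ℂ x h)

theorem atom_apply (h : 𝓢(V, ℂ)) (x ξ t : V) :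
    atom h x ξ t = Complex.exp (2 * Real.pi * Complex.I * (inner ℝ (-ξ) t : ℝ)) * h (t - x) := by
  rw [atom, smulLeftCLM_apply_apply (hasTemperateGrowth_char (-ξ)), compSubConstCLM_apply,
    smul_eq_mul]

theorem exists_apply_ne_zero {W : Type} [NormedAddCommGroup W] [NormedSpace ℝ W] {h : 𝓢(W, ℂ)}
    (hh : h ≠ 0) : ∃ t, h t ≠ 0 := by
  by_contra! H
  exact hh (by ext t; simpa using H t)

theorem schwartzMul_apply (φ ψ : 𝓢(V, ℂ)) (t : V) : smulLeftCLM ℂ (φ : V → ℂ) ψ t = φ t * ψ t := by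
  rw [smulLeftCLM_apply_apply φ.hasTemperateGrowth, smul_eq_mul]

/-- The shear `(x, t) ↦ (x, t - A x)`. -/
noncomputable def shearEquiv {X : Type} [NormedAddCommGroup X] [NormedSpace ℝ X] (A : X →L[ℝ] V) :
    (X × V) ≃L[ℝ] (X × V) :=
  ContinuousLinearEquiv.equivOfInverse
    ((ContinuousLinearMap.fst ℝ X V).prod
      (ContinuousLinearMap.snd ℝ X V - A ∘L ContinuousLinearMap.fst ℝ X V))
    ((ContinuousLinearMap.fst ℝ X V).prod
      (ContinuousLinearMap.snd ℝ X V + A ∘L ContinuousLinearMap.fst ℝ X V))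
    (fun z => by simp) (fun z => by simp)

theorem shearEquiv_apply {X : Type} [NormedAddCommGroup X] [NormedSpace ℝ X] (A : X →L[ℝ] V)
    (z : X × V) : shearEquiv A z = (z.1, z.2 - A z.1) := rfl

variable [FiniteDimensional ℝ V]

/-- The short-time Fourier transform of a tempered distribution is continuous. The function
`(x, ξ, t) ↦ atom h x ξ t` is not a Schwartz function of the three variables, but it becomes one
after multiplication with a bump function in `(x, ξ)`, and then `partialPairing` applies. -/
theorem continuous_apply_atom (T : 𝓢(V, ℂ) →L[ℂ] ℂ) (h : 𝓢(V, ℂ)) :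
    Continuous fun z : V × V => T (atom h z.1 z.2) := by
  rw [continuous_iff_continuousAt]
  intro z₀
  obtain ⟨b⟩ : Nonempty (ContDiffBump z₀) := inferInstance
  let χ : 𝓢(V × V, ℂ) := HasCompactSupport.toSchwartzMap
    (f := fun z => ((b z : ℝ) : ℂ)) (b.hasCompactSupport.comp_left (g := fun r : ℝ => (r : ℂ)) rfl)
    (Complex.ofRealCLM.contDiff.comp b.contDiff)
  have hg : Function.HasTemperateGrowth (fun w : (V × V) × V =>
      Complex.exp (2 * Real.pi * Complex.I * (inner ℝ (-w.1.2) w.2 : ℝ))) := by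
    refine hasTemperateGrowth_cexp ?_
    have h1 : Function.HasTemperateGrowth (fun w : (V × V) × V => -w.1.2) :=
      (-(ContinuousLinearMap.snd ℝ V V ∘L ContinuousLinearMap.fst ℝ (V × V) V)).hasTemperateGrowth
    have h2 : Function.HasTemperateGrowth (fun w : (V × V) × V => w.2) :=
      (ContinuousLinearMap.snd ℝ (V × V) V).hasTemperateGrowth
    exact (innerSL ℝ (E := V)).bilinear_hasTemperateGrowth h1 h2
  let Φ : 𝓢((V × V) × V, ℂ) := smulLeftCLM ℂ (fun w : (V × V) × V =>
      Complex.exp (2 * Real.pi * Complex.I * (inner ℝ (-w.1.2) w.2 : ℝ)))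
    (compCLMOfContinuousLinearEquiv ℂ (shearEquiv (ContinuousLinearMap.fst ℝ V V))
      (schwartzTensor χ h))
  have hΦ : ∀ z, sliceCLM z Φ = χ z • atom h z.1 z.2 := by
    intro z
    ext t
    rw [sliceCLM_apply, smulLeftCLM_apply_apply hg]
    simp only [compCLMOfContinuousLinearEquiv_apply, Function.comp_apply, shearEquiv_apply,
      schwartzTensor_apply, smul_apply, atom_apply, smul_eq_mul, ContinuousLinearMap.coe_fst']
    ring
  have hc : ContinuousAt (fun z => T (sliceCLM z Φ)) z₀ :=
    (partialPairing T Φ).continuous.continuousAt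
  refine hc.congr ?_
  filter_upwards [b.eventuallyEq_one] with z hz
  have hχ : χ z = 1 := by
    change ((b z : ℝ) : ℂ) = 1
    rw [hz]; simp
  rw [hΦ, hχ, one_smul]

variable [MeasurableSpace V] [BorelSpace V]

open FourierTransform

/-- Writing `φ` as the Fourier transform of `𝓕⁻ φ` expands the localization `h(· - x) φ` into atoms
centred at `x`. -/
theorem apply_mul_eq_integral_atom (T : 𝓢(V, ℂ) →L[ℂ] ℂ) (h φ : 𝓢(V, ℂ)) (x : V) :
    T (smulLeftCLM ℂ (compSubConstCLM ℂ x h : 𝓢(V, ℂ)) φ)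
      = ∫ ξ, (𝓕⁻ φ : 𝓢(V, ℂ)) ξ * T (atom h x ξ) := by
  have hg : Function.HasTemperateGrowth (fun w : V × V =>
      Complex.exp (2 * Real.pi * Complex.I * (inner ℝ (-w.1) w.2 : ℝ))) := by
    refine hasTemperateGrowth_cexp ?_
    exact (innerSL ℝ (E := V)).bilinear_hasTemperateGrowth
      (-(ContinuousLinearMap.fst ℝ V V)).hasTemperateGrowth
      (ContinuousLinearMap.snd ℝ V V).hasTemperateGrowth
  let Φ : 𝓢(V × V, ℂ) := smulLeftCLM ℂ (fun w : V × V =>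
      Complex.exp (2 * Real.pi * Complex.I * (inner ℝ (-w.1) w.2 : ℝ)))
    (schwartzTensor (𝓕⁻ φ) (compSubConstCLM ℂ x h))
  have hΦ : ∀ ξ t, Φ (ξ, t) = (𝓕⁻ φ : 𝓢(V, ℂ)) ξ * atom h x ξ t := by
    intro ξ t
    rw [smulLeftCLM_apply_apply hg, schwartzTensor_apply, atom_apply, smul_eq_mul,
      compSubConstCLM_apply]
    ring
  have hsl : ∀ ξ, sliceCLM ξ Φ = (𝓕⁻ φ : 𝓢(V, ℂ)) ξ • atom h x ξ := fun ξ => by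
    ext t; rw [sliceCLM_apply, hΦ]; rfl
  rw [apply_eq_integral_slice volume T Φ]
  · simp only [hsl, map_smul, smul_eq_mul]
  · intro t
    have h1 : φ t = ∫ ξ, Complex.exp (2 * Real.pi * Complex.I * (inner ℝ (-ξ) t : ℝ)) *
        (𝓕⁻ φ : 𝓢(V, ℂ)) ξ := by
      conv_lhs => rw [← FourierTransform.fourier_fourierInv_eq (F := 𝓢(V, ℂ)) φ]
      rw [fourier_coe, Real.fourier_eq']
      refine integral_congr_ae (ae_of_all _ fun ξ => ?_)
      simp only [smul_eq_mul, inner_neg_left]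
      congr 2
      push_cast; ring
    rw [schwartzMul_apply, h1, ← integral_const_mul]
    refine integral_congr_ae (ae_of_all _ fun ξ => ?_)
    simp only [hΦ, atom_apply, compSubConstCLM_apply]
    ring

/-- The translates of `κ` form a continuous partition of unity, up to the factor `∫ κ`, and a
distribution is the integral of its localizations. -/
theorem integral_mul_apply_eq_integral (T : 𝓢(V, ℂ) →L[ℂ] ℂ) (κ φ : 𝓢(V, ℂ)) :
    (∫ t, κ t) * T φ = ∫ x, T (smulLeftCLM ℂ (compSubConstCLM ℂ x κ : 𝓢(V, ℂ)) φ) := by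
  let σ := ContinuousLinearEquiv.prodComm ℝ V V
  let e : (V × V) ≃L[ℝ] (V × V) :=
    (σ.trans (((ContinuousLinearEquiv.refl ℝ V).prodCongr (ContinuousLinearEquiv.neg ℝ)).trans
      (shearEquiv (-ContinuousLinearMap.id ℝ V)))).trans σ
  let Φ : 𝓢(V × V, ℂ) := compCLMOfContinuousLinearEquiv ℂ e (schwartzTensor κ φ)
  have hΦ : ∀ x t, Φ (x, t) = κ (t - x) * φ t := by
    intro x t
    have : e (x, t) = (t - x, t) := by
      simp [e, σ, shearEquiv_apply, sub_eq_add_neg, add_comm]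
    change schwartzTensor κ φ (e (x, t)) = _
    rw [this, schwartzTensor_apply]
  have hsl : ∀ x, sliceCLM x Φ = smulLeftCLM ℂ (compSubConstCLM ℂ x κ : 𝓢(V, ℂ)) φ := fun x => by
    ext t; rw [sliceCLM_apply, hΦ, schwartzMul_apply, compSubConstCLM_apply]
  have := apply_eq_integral_slice volume T Φ ((∫ t, κ t) • φ) (fun t => by
    simp only [hΦ, smul_apply, smul_eq_mul]
    rw [integral_mul_const, integral_sub_left_eq_self (fun x => κ x) volume t])
  simpa only [hsl, map_smul, smul_eq_mul] using this

end Gabor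

/-! ### Norm estimates for the Fourier transform and duality in `L²` -/

section LpEstimates

theorem eLpNorm_rpow_toReal {α E : Type} [MeasurableSpace α] [NormedAddCommGroup E] {μ : Measure α}
    {p : ℝ≥0∞} (hp0 : p ≠ 0) (hp : p ≠ ⊤) (f : α → E) :
    eLpNorm f p μ ^ p.toReal = ∫⁻ x, ‖f x‖ₑ ^ p.toReal ∂μ := by
  rw [eLpNorm_eq_lintegral_rpow_enorm_toReal hp0 hp, ← ENNReal.rpow_mul, one_div,
    inv_mul_cancel₀ (ENNReal.toReal_pos hp0 hp).ne', ENNReal.rpow_one]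

/-- Interpolation between `L²` and `L^∞`. -/
theorem eLpNorm_le_of_two_of_top {α E : Type} [MeasurableSpace α] [NormedAddCommGroup E]
    {μ : Measure α} {u : α → E} {q : ℝ≥0∞} (hq : 2 ≤ q) {a : ℝ≥0∞} (h2 : eLpNorm u 2 μ ≤ a)
    (ht : eLpNorm u ⊤ μ ≤ a) : eLpNorm u q μ ≤ a := by
  rcases eq_or_ne q ⊤ with rfl | hq'
  · exact ht
  rcases eq_or_ne a ⊤ with rfl | ha
  · exact le_top
  have hq0 : q ≠ 0 := (two_pos.trans_le hq).ne'
  have hr : 2 ≤ q.toReal := by simpa using (ENNReal.toReal_le_toReal (by simp) hq').2 hq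
  have hr0 : 0 < q.toReal := by linarith
  rw [← ENNReal.rpow_le_rpow_iff hr0, eLpNorm_rpow_toReal hq0 hq']
  have e2 := eLpNorm_rpow_toReal (μ := μ) two_ne_zero ENNReal.ofNat_ne_top u
  rw [ENNReal.toReal_ofNat] at e2
  calc ∫⁻ x, ‖u x‖ₑ ^ q.toReal ∂μ ≤ ∫⁻ x, a ^ (q.toReal - 2) * ‖u x‖ₑ ^ (2 : ℝ) ∂μ := by
        refine lintegral_mono_ae ?_
        filter_upwards [ae_le_eLpNormEssSup (f := u) (μ := μ)] with x hx
        have hxa : ‖u x‖ₑ ≤ a := hx.trans (by rwa [← eLpNorm_exponent_top])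
        have e : ‖u x‖ₑ ^ q.toReal = ‖u x‖ₑ ^ (q.toReal - 2) * ‖u x‖ₑ ^ (2 : ℝ) := by
          rw [← ENNReal.rpow_add_of_nonneg _ _ (by linarith) (by norm_num), sub_add_cancel]
        rw [e]
        gcongr
    _ = a ^ (q.toReal - 2) * eLpNorm u 2 μ ^ (2 : ℝ) := by
        rw [lintegral_const_mul' _ _ (ENNReal.rpow_ne_top_of_nonneg (by linarith) ha), e2]
    _ ≤ a ^ (q.toReal - 2) * a ^ (2 : ℝ) := by gcongr
    _ = a ^ q.toReal := by
        rw [← ENNReal.rpow_add_of_nonneg _ _ (by linarith) (by norm_num)]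
        congr 1; ring

variable {V : Type} [NormedAddCommGroup V] [InnerProductSpace ℝ V]

theorem schwartzMul_coe (φ ψ : 𝓢(V, ℂ)) :
    ⇑(smulLeftCLM ℂ (φ : V → ℂ) ψ) = (φ : V → ℂ) • (ψ : V → ℂ) := by
  funext t
  rw [schwartzMul_apply]; rfl

variable [FiniteDimensional ℝ V]
  [MeasurableSpace V] [BorelSpace V]

theorem eLpNorm_compSubConst (k : 𝓢(V, ℂ)) (x : V) (q : ℝ≥0∞) :
    eLpNorm (compSubConstCLM ℂ x k : 𝓢(V, ℂ)) q volume = eLpNorm k q volume :=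
  eLpNorm_comp_measurePreserving (g := k) k.continuous.aestronglyMeasurable
    (measurePreserving_sub_right volume x)

theorem eLpNorm_schwartz_ne_top (φ : 𝓢(V, ℂ)) (q : ℝ≥0∞) : eLpNorm φ q volume ≠ ⊤ :=
  (φ.eLpNorm_lt_top q volume).ne

theorem eLpNorm_schwartzMul_le (k ψ : 𝓢(V, ℂ)) (p q r : ℝ≥0∞) [p.HolderTriple q r] :
    eLpNorm (smulLeftCLM ℂ (k : V → ℂ) ψ) r volume ≤ eLpNorm k p volume * eLpNorm ψ q volume := by
  rw [schwartzMul_coe]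
  exact eLpNorm_smul_le_mul_eLpNorm ψ.continuous.aestronglyMeasurable
    k.continuous.aestronglyMeasurable

open FourierTransform

theorem enorm_fourierInv_le (φ : 𝓢(V, ℂ)) (ξ : V) :
    ‖(𝓕⁻ φ : 𝓢(V, ℂ)) ξ‖ₑ ≤ eLpNorm φ 1 volume := by
  rw [fourierInv_coe, Real.fourierInv_eq']
  refine (enorm_integral_le_lintegral_enorm _).trans ?_
  rw [eLpNorm_one_eq_lintegral_enorm]
  refine lintegral_mono fun t => ?_
  rw [enorm_smul]
  have : ‖Complex.exp (↑(2 * Real.pi * inner ℝ t ξ) * Complex.I)‖ₑ = 1 := by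
    rw [← ofReal_norm, Complex.norm_exp_ofReal_mul_I, ENNReal.ofReal_one]
  rw [this, one_mul]

theorem eLpNorm_fourierInv_two (φ : 𝓢(V, ℂ)) :
    eLpNorm (𝓕⁻ φ : 𝓢(V, ℂ)) 2 volume = eLpNorm φ 2 volume := by
  have h := norm_fourier_toL2_eq (𝓕⁻ φ : 𝓢(V, ℂ))
  rw [FourierTransform.fourier_fourierInv_eq, norm_toLp, norm_toLp] at h
  exact ((ENNReal.toReal_eq_toReal_iff' (eLpNorm_schwartz_ne_top φ 2)
    (eLpNorm_schwartz_ne_top (𝓕⁻ φ) 2)).1 h).symm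

theorem eLpNorm_top_fourierInv_mul_le (k ψ : 𝓢(V, ℂ)) (ξ : V) :
    ‖(𝓕⁻ (smulLeftCLM ℂ (k : V → ℂ) ψ) : 𝓢(V, ℂ)) ξ‖ₑ
      ≤ eLpNorm k 2 volume * eLpNorm ψ 2 volume :=
  (enorm_fourierInv_le _ _).trans (eLpNorm_schwartzMul_le k ψ 2 2 1)

theorem eLpNorm_fourierInv_mul_le (k ψ : 𝓢(V, ℂ)) {q : ℝ≥0∞} (hq : 2 ≤ q) :
    eLpNorm (𝓕⁻ (smulLeftCLM ℂ (k : V → ℂ) ψ) : 𝓢(V, ℂ)) q volume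
      ≤ max (eLpNorm k 2 volume) (eLpNorm k ⊤ volume) * eLpNorm ψ 2 volume := by
  refine eLpNorm_le_of_two_of_top hq ?_ ?_
  · rw [eLpNorm_fourierInv_two]
    refine (eLpNorm_schwartzMul_le k ψ ⊤ 2 2).trans ?_
    gcongr
    exact le_max_right _ _
  · rw [eLpNorm_exponent_top]
    refine eLpNormEssSup_le_of_ae_enorm_bound (ae_of_all _ fun ξ => ?_)
    refine (eLpNorm_top_fourierInv_mul_le k ψ ξ).trans ?_
    gcongr
    exact le_max_left _ _

/-- A functional on the Schwartz space that is bounded in the `L²` norm is given by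
an `L²` function. -/
theorem exists_memLp_two_of_bound (Λ : 𝓢(V, ℂ) →ₗ[ℂ] ℂ) (K : ℝ≥0∞) (hK : K ≠ ⊤)
    (h : ∀ ψ : 𝓢(V, ℂ), ‖Λ ψ‖ₑ ≤ K * eLpNorm ψ 2 volume) :
    ∃ u : V → ℂ, MemLp u 2 volume ∧ eLpNorm u 2 volume ≤ K ∧ ∀ ψ : 𝓢(V, ℂ), Λ ψ = ∫ t, ψ t * u t := by
  let J : 𝓢(V, ℂ) →ₗ[ℂ] Lp ℂ 2 (volume : Measure V) := (toLpCLM ℂ ℂ 2 volume).toLinearMap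
  have hinj : Function.Injective J := injective_toLp 2 volume
  have hb : ∀ ψ, ‖Λ ψ‖ ≤ K.toReal * ‖J ψ‖ := by
    intro ψ
    have e : ‖J ψ‖ = (eLpNorm ψ 2 volume).toReal := norm_toLp
    rw [e, ← ENNReal.toReal_mul, ← toReal_enorm]
    exact ENNReal.toReal_mono (ENNReal.mul_ne_top hK (eLpNorm_schwartz_ne_top ψ 2)) (h ψ)
  let e := LinearEquiv.ofInjective J hinj
  have hl : ∀ v, ‖(Λ ∘ₗ e.symm.toLinearMap) v‖ ≤ K.toReal * ‖v‖ := fun v => by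
    obtain ⟨ψ, rfl⟩ := e.surjective v
    change ‖Λ (e.symm (e ψ))‖ ≤ _
    rw [e.symm_apply_apply]
    exact hb ψ
  obtain ⟨l, hl1, hl2⟩ := exists_extension_norm_eq _
    (LinearMap.mkContinuous (Λ ∘ₗ e.symm.toLinearMap) K.toReal hl)
  have hln : ‖l‖ ≤ K.toReal := hl2.trans_le (LinearMap.mkContinuous_norm_le _ ENNReal.toReal_nonneg _)
  let w := (InnerProductSpace.toDual ℂ (Lp ℂ 2 (volume : Measure V))).symm l
  refine ⟨star w, (Lp.memLp w).star, ?_, fun ψ => ?_⟩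
  · rw [eLpNorm_star]
    have hw : ‖w‖ ≤ K.toReal := by
      rw [LinearIsometryEquiv.norm_map]; exact hln
    rw [Lp.norm_def] at hw
    exact (ENNReal.toReal_le_toReal (Lp.memLp w).2.ne hK).1 hw
  · have h1 : l (J ψ) = Λ ψ := by
      have := hl1 (e ψ)
      change l (J ψ) = Λ (e.symm (e ψ)) at this
      rwa [e.symm_apply_apply] at this
    rw [← h1, ← InnerProductSpace.toDual_symm_apply (𝕜 := ℂ) (x := J ψ) (y := l), L2.inner_def]
    refine integral_congr_ae ?_
    filter_upwards [ψ.coeFn_toLp 2 volume] with t ht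
    have : (J ψ : V → ℂ) t = ψ t := ht
    rw [this]
    rfl

end LpEstimates

/-! ### Bounds in the `L²` norm from the short-time Fourier transform -/

section LocalBounds

open FourierTransform

variable {V : Type} [NormedAddCommGroup V] [InnerProductSpace ℝ V] [FiniteDimensional ℝ V]
  [MeasurableSpace V] [BorelSpace V]

/-- Hölder's inequality for `p` and the dual exponent `(1 - p⁻¹)⁻¹`. -/
theorem eLpNorm_one_mul_le {α : Type} [MeasurableSpace α] {μ : Measure α} {u H : α → ℂ}
    (hu : AEStronglyMeasurable u μ) (hH : AEStronglyMeasurable H μ) {p : ℝ≥0∞} (hp : 1 ≤ p) :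
    ∫⁻ x, ‖u x * H x‖ₑ ∂μ ≤ eLpNorm u (1 - p⁻¹)⁻¹ μ * eLpNorm H p μ := by
  have : ENNReal.HolderConjugate p (1 - p⁻¹)⁻¹ := ENNReal.HolderConjugate.inv_one_sub_inv' hp
  have : ENNReal.HolderConjugate (1 - p⁻¹)⁻¹ p := this.symm
  refine le_trans (le_of_eq ?_) (eLpNorm_smul_le_mul_eLpNorm (r := 1) hH hu)
  rw [eLpNorm_one_eq_lintegral_enorm]
  rfl

theorem two_le_conjExponent {p : ℝ≥0∞} (hp : p ≤ 2) : 2 ≤ (1 - p⁻¹)⁻¹ := by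
  rw [ENNReal.le_inv_iff_le_inv, tsub_le_iff_right]
  calc (1 : ℝ≥0∞) = 2⁻¹ + 2⁻¹ := (ENNReal.inv_two_add_inv_two).symm
    _ ≤ _ := by gcongr

/-- Pointwise in `x`, the functional `ψ ↦ T (h(· - x) k(· - x) ψ)` is bounded in the `L²` norm by the
`L^p` norm in the frequency variable of the short-time Fourier transform. -/
theorem enorm_apply_mul_mul_le (T : 𝓢(V, ℂ) →L[ℂ] ℂ) (h k ψ : 𝓢(V, ℂ)) (x : V) {p : ℝ≥0∞}
    (hp1 : 1 ≤ p) (hp2 : p ≤ 2) :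
    ‖T (smulLeftCLM ℂ (compSubConstCLM ℂ x h : 𝓢(V, ℂ))
        (smulLeftCLM ℂ (compSubConstCLM ℂ x k : 𝓢(V, ℂ)) ψ))‖ₑ
      ≤ max (eLpNorm k 2 volume) (eLpNorm k ⊤ volume)
        * eLpNorm (fun ξ => T (atom h x ξ)) p volume * eLpNorm ψ 2 volume := by
  rw [apply_mul_eq_integral_atom]
  refine (enorm_integral_le_lintegral_enorm _).trans ?_
  have hc := (continuous_apply_atom T h).comp
    (Continuous.prodMk_right x : Continuous fun ξ : V => (x, ξ))
  refine (eLpNorm_one_mul_le (SchwartzMap.continuous _).aestronglyMeasurable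
    hc.aestronglyMeasurable hp1).trans ?_
  rw [mul_right_comm]
  refine mul_le_mul' ?_ le_rfl
  have := eLpNorm_fourierInv_mul_le (compSubConstCLM ℂ x k) ψ (two_le_conjExponent hp2)
  rwa [eLpNorm_compSubConst, eLpNorm_compSubConst] at this

theorem continuous_fourierInv_mul (κ φ : 𝓢(V, ℂ)) : Continuous fun z : V × V =>
    (𝓕⁻ (smulLeftCLM ℂ (compSubConstCLM ℂ z.1 κ : 𝓢(V, ℂ)) φ) : 𝓢(V, ℂ)) z.2 := by
  let Tφ : 𝓢(V, ℂ) →L[ℂ] ℂ := integralCLM ℂ volume ∘L smulLeftCLM ℂ (φ : V → ℂ)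
  have e : ∀ z : V × V, (𝓕⁻ (smulLeftCLM ℂ (compSubConstCLM ℂ z.1 κ : 𝓢(V, ℂ)) φ) : 𝓢(V, ℂ)) z.2
      = Tφ (atom κ z.1 (-z.2)) := by
    intro z
    rw [fourierInv_coe, Real.fourierInv_eq']
    change _ = integralCLM ℂ volume (smulLeftCLM ℂ (φ : V → ℂ) (atom κ z.1 (-z.2)))
    rw [integralCLM_apply]
    refine integral_congr_ae (ae_of_all _ fun t => ?_)
    simp only [schwartzMul_apply, atom_apply, smul_eq_mul, compSubConstCLM_apply, neg_neg]
    rw [real_inner_comm]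
    push_cast
    rw [show (2 * Real.pi * Complex.I * (inner ℝ z.2 t : ℝ) : ℂ)
      = 2 * Real.pi * (inner ℝ z.2 t : ℝ) * Complex.I by ring]
    ring
  simp only [e]
  have hc := (continuous_apply_atom Tφ κ).comp
    (by fun_prop : Continuous fun z : V × V => (z.1, -z.2))
  exact hc

/-- The `L²` norm identity for the short-time Fourier transform of a Schwartz function. -/
theorem eLpNorm_two_fourierInv_mul (κ φ : 𝓢(V, ℂ)) : eLpNorm (fun z : V × V =>
      (𝓕⁻ (smulLeftCLM ℂ (compSubConstCLM ℂ z.1 κ : 𝓢(V, ℂ)) φ) : 𝓢(V, ℂ)) z.2) 2 volume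
    = eLpNorm κ 2 volume * eLpNorm φ 2 volume := by
  have hpow : ∀ {α : Type} [MeasurableSpace α] (μ : Measure α) (u : α → ℂ),
      eLpNorm u 2 μ ^ (2 : ℝ) = ∫⁻ x, ‖u x‖ₑ ^ (2 : ℝ) ∂μ := fun μ u => by
    have e2 := eLpNorm_rpow_toReal (μ := μ) two_ne_zero ENNReal.ofNat_ne_top u
    rwa [ENNReal.toReal_ofNat] at e2
  have hm := (continuous_fourierInv_mul κ φ).enorm.measurable.pow_const (2 : ℝ)
  have hm2 : Measurable fun z : V × V => ‖κ (z.2 - z.1)‖ₑ ^ (2 : ℝ) * ‖φ z.2‖ₑ ^ (2 : ℝ) := by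
    have h1 : Continuous fun z : V × V => κ (z.2 - z.1) := κ.continuous.comp (by fun_prop)
    have h2 : Continuous fun z : V × V => φ z.2 := φ.continuous.comp (by fun_prop)
    exact (h1.enorm.measurable.pow_const _).mul (h2.enorm.measurable.pow_const _)
  have key : eLpNorm (fun z : V × V =>
      (𝓕⁻ (smulLeftCLM ℂ (compSubConstCLM ℂ z.1 κ : 𝓢(V, ℂ)) φ) : 𝓢(V, ℂ)) z.2) 2 volume ^ (2 : ℝ)
      = (eLpNorm κ 2 volume * eLpNorm φ 2 volume) ^ (2 : ℝ) := by
    rw [hpow, ENNReal.mul_rpow_of_nonneg _ _ (by norm_num), Measure.volume_eq_prod,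
      lintegral_prod _ hm.aemeasurable]
    have h1 : ∀ x : V, ∫⁻ ξ, ‖(𝓕⁻ (smulLeftCLM ℂ (compSubConstCLM ℂ x κ : 𝓢(V, ℂ)) φ) : 𝓢(V, ℂ)) ξ‖ₑ
        ^ (2 : ℝ) = ∫⁻ t, ‖κ (t - x)‖ₑ ^ (2 : ℝ) * ‖φ t‖ₑ ^ (2 : ℝ) := by
      intro x
      rw [← hpow, eLpNorm_fourierInv_two, hpow]
      refine lintegral_congr fun t => ?_
      rw [schwartzMul_apply, compSubConstCLM_apply, enorm_mul,
        ENNReal.mul_rpow_of_nonneg _ _ (by norm_num)]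
    simp only [h1]
    rw [lintegral_lintegral_swap hm2.aemeasurable]
    have h2 : ∀ t : V, ∫⁻ x, ‖κ (t - x)‖ₑ ^ (2 : ℝ) * ‖φ t‖ₑ ^ (2 : ℝ)
        = eLpNorm κ 2 volume ^ (2 : ℝ) * ‖φ t‖ₑ ^ (2 : ℝ) := by
      intro t
      rw [lintegral_mul_const' _ _ (ENNReal.rpow_ne_top_of_nonneg (by norm_num) enorm_ne_top),
        lintegral_sub_left_eq_self (fun x => ‖κ x‖ₑ ^ (2 : ℝ)) t, hpow]
    simp only [h2]
    rw [lintegral_const_mul' _ _ (ENNReal.rpow_ne_top_of_nonneg (by norm_num)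
      (eLpNorm_schwartz_ne_top κ 2)), hpow volume φ]
  exact (ENNReal.rpow_left_injective (two_ne_zero)) key

/-- A tempered distribution whose short-time Fourier transform is in `L^p`, `1 ≤ p ≤ 2`, is bounded in
the `L²` norm: `∫ h κ · T φ` is the pairing of its short-time Fourier transform with that of `φ`, whose
norm in the dual space `L^{p'}`, `p' ≥ 2`, is bounded by interpolation between `L²` and `L^∞`. -/
theorem enorm_mul_apply_le (T : 𝓢(V, ℂ) →L[ℂ] ℂ) (h κ φ : 𝓢(V, ℂ)) {p : ℝ≥0∞}
    (hp1 : 1 ≤ p) (hp2 : p ≤ 2) :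
    ‖(∫ t, h t * κ t) * T φ‖ₑ ≤ eLpNorm κ 2 volume
      * eLpNorm (fun z : V × V => T (atom h z.1 z.2)) p volume * eLpNorm φ 2 volume := by
  have e0 := integral_mul_apply_eq_integral T (smulLeftCLM ℂ (h : V → ℂ) κ) φ
  simp only [schwartzMul_apply] at e0
  have e1 : ∀ x, smulLeftCLM ℂ (compSubConstCLM ℂ x (smulLeftCLM ℂ (h : V → ℂ) κ) : 𝓢(V, ℂ)) φ
      = smulLeftCLM ℂ (compSubConstCLM ℂ x h : 𝓢(V, ℂ))
        (smulLeftCLM ℂ (compSubConstCLM ℂ x κ : 𝓢(V, ℂ)) φ) := by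
    intro x
    ext t
    simp only [schwartzMul_apply, compSubConstCLM_apply, mul_assoc]
  rw [e0]
  simp only [e1, apply_mul_eq_integral_atom]
  set u : V × V → ℂ := fun z =>
    (𝓕⁻ (smulLeftCLM ℂ (compSubConstCLM ℂ z.1 κ : 𝓢(V, ℂ)) φ) : 𝓢(V, ℂ)) z.2 with hu
  have huc : Continuous u := continuous_fourierInv_mul κ φ
  have hHc := continuous_apply_atom T h
  calc _ ≤ ∫⁻ x, ‖∫ ξ, u (x, ξ) * T (atom h x ξ)‖ₑ := enorm_integral_le_lintegral_enorm _
    _ ≤ ∫⁻ x, ∫⁻ ξ, ‖u (x, ξ) * T (atom h x ξ)‖ₑ :=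
        lintegral_mono fun x => enorm_integral_le_lintegral_enorm _
    _ = ∫⁻ z : V × V, ‖u z * T (atom h z.1 z.2)‖ₑ := by
        rw [Measure.volume_eq_prod, lintegral_prod]
        exact (huc.mul hHc).enorm.measurable.aemeasurable
    _ ≤ eLpNorm u (1 - p⁻¹)⁻¹ volume * eLpNorm (fun z : V × V => T (atom h z.1 z.2)) p volume :=
        eLpNorm_one_mul_le huc.aestronglyMeasurable hHc.aestronglyMeasurable hp1
    _ ≤ (eLpNorm κ 2 volume * eLpNorm φ 2 volume)
          * eLpNorm (fun z : V × V => T (atom h z.1 z.2)) p volume := by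
        gcongr
        refine eLpNorm_le_of_two_of_top (two_le_conjExponent hp2)
          (eLpNorm_two_fourierInv_mul κ φ).le ?_
        rw [eLpNorm_exponent_top]
        refine eLpNormEssSup_le_of_ae_enorm_bound (ae_of_all _ fun z => ?_)
        have := eLpNorm_top_fourierInv_mul_le (compSubConstCLM ℂ z.1 κ) φ z.2
        rwa [eLpNorm_compSubConst] at this
    _ = _ := by rw [mul_right_comm]

end LocalBounds

/-! ### Distributions whose short-time Fourier transform is in a weighted `L^p` space -/

section WeightedLp

/-- The weight `v_s` on a normed space. -/
noncomputable def polyWeight {V : Type} [NormedAddCommGroup V] (s : ℝ) (z : V) : ℝ :=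
  (1 + ‖z‖ ^ 2) ^ (s / 2)

section Weight
variable {V : Type} [NormedAddCommGroup V]

theorem polyWeight_pos (s : ℝ) (z : V) : 0 < polyWeight s z := by
  unfold polyWeight; positivity

theorem one_le_polyWeight {s : ℝ} (hs : 0 ≤ s) (z : V) : 1 ≤ polyWeight s z :=
  Real.one_le_rpow (by nlinarith [sq_nonneg ‖z‖]) (by linarith)

theorem continuous_polyWeight (s : ℝ) : Continuous (polyWeight s : V → ℝ) := by
  unfold polyWeight
  exact (by fun_prop : Continuous fun z : V => 1 + ‖z‖ ^ 2).rpow_const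
    fun z => Or.inl (by positivity)

/-- The weight is moderate with respect to itself; `L` bounds the norms of the two points. -/
theorem polyWeight_le_mul {X Y : Type} [NormedAddCommGroup X] [NormedAddCommGroup Y] {s : ℝ}
    (hs : 0 ≤ s) {L : ℝ} (hL : 1 ≤ L) {z : V} {x : X} {y : Y}
    (h : ‖z‖ ≤ L * (‖x‖ + ‖y‖)) :
    polyWeight s z ≤ (2 * L ^ 2) ^ (s / 2) * (polyWeight s x * polyWeight s y) := by
  unfold polyWeight
  rw [← Real.mul_rpow (by positivity) (by positivity), ← Real.mul_rpow (by positivity) (by positivity)]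
  refine Real.rpow_le_rpow (by positivity) ?_ (by linarith)
  have h1 : ‖z‖ ^ 2 ≤ (L * (‖x‖ + ‖y‖)) ^ 2 := by gcongr
  have h2 : 1 ≤ L ^ 2 := one_le_pow₀ hL
  have h3 : (‖x‖ + ‖y‖) ^ 2 ≤ 2 * (‖x‖ ^ 2 + ‖y‖ ^ 2) := by nlinarith [sq_nonneg (‖x‖ - ‖y‖)]
  have h4 : L ^ 2 * (‖x‖ + ‖y‖) ^ 2 ≤ L ^ 2 * (2 * (‖x‖ ^ 2 + ‖y‖ ^ 2)) := by gcongr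
  nlinarith [mul_nonneg (sq_nonneg ‖x‖) (sq_nonneg ‖y‖), mul_nonneg (sq_nonneg L)
    (mul_nonneg (sq_nonneg ‖x‖) (sq_nonneg ‖y‖))]

theorem polyWeight_le_of_norm_le {X : Type} [NormedAddCommGroup X] {s : ℝ}
    (hs : 0 ≤ s) {L : ℝ} (hL : 1 ≤ L) {z : V} {x : X} (h : ‖z‖ ≤ L * ‖x‖) :
    polyWeight s z ≤ (2 * L ^ 2) ^ (s / 2) * polyWeight s x := by
  have := polyWeight_le_mul (s := s) hs hL (z := z) (x := x) (y := (0 : ℝ)) (by simpa using h)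
  simpa [polyWeight] using this

end Weight

variable {V : Type} [NormedAddCommGroup V] [InnerProductSpace ℝ V] [FiniteDimensional ℝ V]
  [MeasurableSpace V] [BorelSpace V]

theorem toTemperedDistribution_toLp_apply {u : V → ℂ} {q : ℝ≥0∞} [Fact (1 ≤ q)]
    (hu : MemLp u q volume) (ψ : 𝓢(V, ℂ)) :
    Lp.toTemperedDistribution hu.toLp ψ = ∫ t, ψ t * u t := by
  rw [Lp.toTemperedDistribution_apply]
  refine integral_congr_ae ?_
  filter_upwards [hu.coeFn_toLp] with t ht
  rw [ht, smul_eq_mul]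

theorem ae_eq_of_forall_integral_schwartz_eq {u v : V → ℂ} {q : ℝ≥0∞} (hq : 1 ≤ q)
    (hu : MemLp u q volume) (hv : MemLp v q volume)
    (h : ∀ ψ : 𝓢(V, ℂ), ∫ t, ψ t * u t = ∫ t, ψ t * v t) : u =ᵐ[volume] v := by
  have : Fact (1 ≤ q) := ⟨hq⟩
  have hinj := LinearMap.ker_eq_bot.1
    (Lp.ker_toTemperedDistributionCLM_eq_bot (F := ℂ) (μ := (volume : Measure V)) (p := q))
  have : hu.toLp = hv.toLp := hinj (by
    change Lp.toTemperedDistribution hu.toLp = Lp.toTemperedDistribution hv.toLp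
    ext ψ
    rw [toTemperedDistribution_toLp_apply, toTemperedDistribution_toLp_apply, h])
  exact (MemLp.toLp_eq_toLp_iff hu hv).1 this

theorem integral_mul_conj_ne_zero {h : 𝓢(V, ℂ)} (hh : h ≠ 0) :
    ∫ t, h t * schwartzConj h t ≠ 0 := by
  have e : ∀ t, h t * schwartzConj h t = ((‖h t‖ ^ 2 : ℝ) : ℂ) := fun t => by
    rw [schwartzConj_apply, Complex.mul_conj, Complex.normSq_eq_norm_sq]
  simp only [e]
  rw [integral_complex_ofReal, Complex.ofReal_ne_zero]
  obtain ⟨t₀, ht₀⟩ := exists_apply_ne_zero hh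
  have hint : Integrable fun t => ‖h t‖ ^ 2 := by
    refine (smulLeftCLM ℂ (h : V → ℂ) h).integrable.norm.congr (ae_of_all _ fun t => ?_)
    simp only [schwartzMul_apply, norm_mul, sq]
  exact (integral_pos_of_integrable_nonneg_nonzero (h.continuous.norm.pow 2) hint
    (fun t => sq_nonneg ‖h t‖) (x := t₀) (by simpa using ht₀)).ne'

/-- A tempered distribution whose short-time Fourier transform is in `L^p`, `1 ≤ p ≤ 2`, is an `L²`
function, and its localizations are bounded in `L²` by the `L^p` norms of the
short-time Fourier transform in the frequency variable. -/
theorem exists_memLp_two_of_stft (T : 𝓢(V, ℂ) →L[ℂ] ℂ) {h : 𝓢(V, ℂ)} (hh : h ≠ 0) {p : ℝ≥0∞}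
    (hp1 : 1 ≤ p) (hp2 : p ≤ 2)
    (hH : eLpNorm (fun z : V × V => T (atom h z.1 z.2)) p volume ≠ ⊤) :
    ∃ F : V → ℂ, MemLp F 2 volume ∧ (∀ φ : 𝓢(V, ℂ), T φ = ∫ t, φ t * F t) ∧
      ∃ C : ℝ≥0∞, C ≠ ⊤ ∧ ∀ x : V,
        eLpNorm (fun t => h (t - x) * (schwartzConj h (t - x) * F t)) 2 volume
          ≤ C * eLpNorm (fun ξ => T (atom h x ξ)) p volume := by
  have hc0 := integral_mul_conj_ne_zero hh
  set c := ∫ t, h t * schwartzConj h t with hc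
  obtain ⟨F, hF, -, hTF⟩ := exists_memLp_two_of_bound T.toLinearMap
    (‖c‖ₑ⁻¹ * (eLpNorm (schwartzConj h) 2 volume
      * eLpNorm (fun z : V × V => T (atom h z.1 z.2)) p volume))
    (ENNReal.mul_ne_top (ENNReal.inv_ne_top.2 (enorm_ne_zero.2 hc0))
      (ENNReal.mul_ne_top (eLpNorm_schwartz_ne_top _ 2) hH)) (fun φ => by
        have := enorm_mul_apply_le T h (schwartzConj h) φ hp1 hp2
        rw [← hc, enorm_mul] at this
        rw [mul_assoc, ← ENNReal.div_eq_inv_mul,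
          ENNReal.le_div_iff_mul_le (Or.inl (enorm_ne_zero.2 hc0)) (Or.inl enorm_ne_top), mul_comm]
        exact this)
  refine ⟨F, hF, hTF, max (eLpNorm (schwartzConj h) 2 volume) (eLpNorm (schwartzConj h) ⊤ volume),
    (max_lt (eLpNorm_schwartz_ne_top _ 2).lt_top (eLpNorm_schwartz_ne_top _ ⊤).lt_top).ne,
    fun x => ?_⟩
  set K := max (eLpNorm (schwartzConj h) 2 volume) (eLpNorm (schwartzConj h) ⊤ volume)
    * eLpNorm (fun ξ => T (atom h x ξ)) p volume with hK
  rcases eq_or_ne K ⊤ with hKt | hKt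
  · rw [hKt]; exact le_top
  obtain ⟨u, hu, huK, hTu⟩ := exists_memLp_two_of_bound
    (T ∘L smulLeftCLM ℂ (compSubConstCLM ℂ x h : 𝓢(V, ℂ)) ∘L
      smulLeftCLM ℂ (compSubConstCLM ℂ x (schwartzConj h) : 𝓢(V, ℂ))).toLinearMap K hKt
    (fun ψ => enorm_apply_mul_mul_le T h (schwartzConj h) ψ x hp1 hp2)
  have hbd : MemLp (fun t => h (t - x) * (schwartzConj h (t - x) * F t)) 2 volume := by
    have h1 := hF.mul (p := ⊤) (r := 2)
      ((compSubConstCLM ℂ x (schwartzConj h) : 𝓢(V, ℂ)).memLp ⊤ volume)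
    exact h1.mul (p := ⊤) (r := 2) ((compSubConstCLM ℂ x h : 𝓢(V, ℂ)).memLp ⊤ volume)
  have hae : (fun t => h (t - x) * (schwartzConj h (t - x) * F t)) =ᵐ[volume] u := by
    refine ae_eq_of_forall_integral_schwartz_eq one_le_two hbd hu fun ψ => ?_
    rw [← hTu]
    change _ = T.toLinearMap (smulLeftCLM ℂ (compSubConstCLM ℂ x h : 𝓢(V, ℂ))
      (smulLeftCLM ℂ (compSubConstCLM ℂ x (schwartzConj h) : 𝓢(V, ℂ)) ψ))
    rw [hTF]
    refine integral_congr_ae (ae_of_all _ fun t => ?_)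
    simp only [schwartzMul_apply, compSubConstCLM_apply]
    ring
  rw [eLpNorm_congr_ae hae]
  exact huK

/-- For `1 ≤ p ≤ 2` a tempered distribution whose short-time Fourier transform is in `L^p`, with the
weight `v_s` in the position variable, is a function in `L^p_{v_s}`. -/
theorem exists_memLp_weight_of_stft (T : 𝓢(V, ℂ) →L[ℂ] ℂ) {h : 𝓢(V, ℂ)} (hh : h ≠ 0) {p : ℝ≥0∞}
    (hp1 : 1 ≤ p) (hp2 : p ≤ 2) {s : ℝ} (hs : 0 ≤ s)
    (hH : MemLp (fun z : V × V => (polyWeight s z.1 : ℂ) * T (atom h z.1 z.2)) p volume) :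
    ∃ F : V → ℂ, MemLp (fun t => (polyWeight s t : ℂ) * F t) p volume ∧
      ∀ φ : 𝓢(V, ℂ), T φ = ∫ t, φ t * F t := by
  have hp0 : p ≠ 0 := (one_pos.trans_le hp1).ne'
  have hpt : p ≠ ⊤ := (hp2.trans_lt ENNReal.ofNat_lt_top).ne
  set r := p.toReal with hr
  have hr0 : 0 < r := ENNReal.toReal_pos hp0 hpt
  have hwn : ∀ t : V, ‖(polyWeight s t : ℂ)‖ = polyWeight s t := fun t => by
    rw [Complex.norm_real, Real.norm_of_nonneg (polyWeight_pos s t).le]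
  have hwc : Continuous fun t : V => (polyWeight s t : ℂ) :=
    Complex.continuous_ofReal.comp (continuous_polyWeight s)
  have hHc := continuous_apply_atom T h
  have hH0 : eLpNorm (fun z : V × V => T (atom h z.1 z.2)) p volume ≠ ⊤ := by
    refine ((eLpNorm_mono fun z => ?_).trans_lt hH.2).ne
    rw [norm_mul, hwn]
    exact le_mul_of_one_le_left (norm_nonneg _) (one_le_polyWeight hs _)
  obtain ⟨F, hF, hTF, C, hC, hloc⟩ := exists_memLp_two_of_stft T hh hp1 hp2 hH0
  refine ⟨F, ⟨hwc.aestronglyMeasurable.mul hF.1, ?_⟩, hTF⟩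
  set B : V → ℝ≥0∞ := fun x => eLpNorm (fun ξ => T (atom h x ξ)) p volume
  -- the exponent `q` with `1/p = 1/2 + 1/q`
  set q : ℝ≥0∞ := (p⁻¹ - 2⁻¹)⁻¹
  have hq : ENNReal.HolderTriple 2 q p := ⟨by
    rw [inv_inv, add_tsub_cancel_of_le (ENNReal.inv_le_inv.2 hp2)]⟩
  -- the constant of `polyWeight_le_mul` for `L = 1`
  set c : ℝ := (2 * 1 ^ 2) ^ (s / 2) with hcdef
  have hc0 : 0 ≤ c := by positivity
  -- `|h|³`: two factors come from the local `L²` bound, one is spent on Hölder's inequality; dividing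
  -- by the weight at `t - x` allows to replace the weight at `t` by the weight at `x`
  set η : V → ℂ := fun y => ((‖h y‖ ^ 3 / polyWeight s y : ℝ) : ℂ) with hη
  have hηc : Continuous η := Complex.continuous_ofReal.comp
    ((h.continuous.norm.pow 3).div (continuous_polyWeight s) fun y => (polyWeight_pos s y).ne')
  have hpoint : ∀ x t : V, ‖(polyWeight s t : ℂ) * F t‖ₑ * ‖η (t - x)‖ₑ
      ≤ ‖(c * polyWeight s x : ℂ)‖ₑ
        * ‖h (t - x) * (h (t - x) * (schwartzConj h (t - x) * F t))‖ₑ := by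
    intro x t
    rw [← enorm_mul, ← enorm_mul, enorm_le_iff_norm_le]
    have h1 : polyWeight s t ≤ c * (polyWeight s x * polyWeight s (t - x)) := by
      refine polyWeight_le_mul hs le_rfl ?_
      rw [one_mul]
      calc ‖t‖ = ‖x + (t - x)‖ := by rw [add_sub_cancel]
        _ ≤ _ := norm_add_le _ _
    have hn : ‖schwartzConj h (t - x)‖ = ‖h (t - x)‖ := by
      rw [schwartzConj_apply, RCLike.norm_conj]
    have hηn : ‖η (t - x)‖ = ‖h (t - x)‖ ^ 3 / polyWeight s (t - x) := by
      rw [hη, Complex.norm_real, Real.norm_of_nonneg]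
      have := polyWeight_pos s (t - x)
      positivity
    simp only [norm_mul, hwn, hηn, hn, Complex.norm_real, Real.norm_of_nonneg hc0]
    have hw := polyWeight_pos s (t - x)
    rw [mul_div_assoc', div_le_iff₀ hw]
    calc polyWeight s t * ‖F t‖ * ‖h (t - x)‖ ^ 3
        ≤ c * (polyWeight s x * polyWeight s (t - x)) * ‖F t‖ * ‖h (t - x)‖ ^ 3 := by gcongr
      _ = _ := by ring
  have hinner : ∀ x : V, ∫⁻ t, (‖(polyWeight s t : ℂ) * F t‖ₑ * ‖η (t - x)‖ₑ) ^ r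
      ≤ (‖(c : ℂ)‖ₑ * eLpNorm h q volume * C) ^ r * (‖(polyWeight s x : ℂ)‖ₑ * B x) ^ r := by
    intro x
    have hm : AEStronglyMeasurable (fun t => h (t - x) * (schwartzConj h (t - x) * F t)) volume :=
      (compSubConstCLM ℂ x h : 𝓢(V, ℂ)).continuous.aestronglyMeasurable.mul
        ((compSubConstCLM ℂ x (schwartzConj h) : 𝓢(V, ℂ)).continuous.aestronglyMeasurable.mul hF.1)
    have hhol : eLpNorm (fun t => h (t - x) * (h (t - x) * (schwartzConj h (t - x) * F t))) p volume
        ≤ eLpNorm h q volume * (C * B x) := by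
      have : ENNReal.HolderTriple q 2 p := hq.symm
      refine (eLpNorm_smul_le_mul_eLpNorm (p := q) (q := 2) (r := p) hm
        (compSubConstCLM ℂ x h : 𝓢(V, ℂ)).continuous.aestronglyMeasurable).trans ?_
      rw [eLpNorm_compSubConst]
      gcongr
      exact hloc x
    calc ∫⁻ t, (‖(polyWeight s t : ℂ) * F t‖ₑ * ‖η (t - x)‖ₑ) ^ r
        ≤ ∫⁻ t, (‖(c * polyWeight s x : ℂ)‖ₑ
          * ‖h (t - x) * (h (t - x) * (schwartzConj h (t - x) * F t))‖ₑ) ^ r :=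
          lintegral_mono fun t => ENNReal.rpow_le_rpow (hpoint x t) hr0.le
      _ = ‖(c * polyWeight s x : ℂ)‖ₑ ^ r *
          eLpNorm (fun t => h (t - x) * (h (t - x) * (schwartzConj h (t - x) * F t))) p volume ^ r := by
          simp only [ENNReal.mul_rpow_of_nonneg _ _ hr0.le]
          rw [lintegral_const_mul' _ _ (ENNReal.rpow_ne_top_of_nonneg hr0.le enorm_ne_top),
            eLpNorm_rpow_toReal hp0 hpt]
      _ ≤ ‖(c * polyWeight s x : ℂ)‖ₑ ^ r * (eLpNorm h q volume * (C * B x)) ^ r := by gcongr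
      _ = _ := by
          rw [enorm_mul]
          simp only [ENNReal.mul_rpow_of_nonneg _ _ hr0.le]
          ring
  have hB : ∫⁻ x, (‖(polyWeight s x : ℂ)‖ₑ * B x) ^ r < ⊤ := by
    have h1 := (eLpNorm_lt_top_iff_lintegral_rpow_enorm_lt_top hp0 hpt).1 hH.2
    have hm : Continuous fun z : V × V => (polyWeight s z.1 : ℂ) * T (atom h z.1 z.2) :=
      (hwc.comp continuous_fst).mul hHc
    rw [Measure.volume_eq_prod, lintegral_prod _ (hm.enorm.measurable.pow_const _).aemeasurable]
      at h1
    refine lt_of_le_of_lt (le_of_eq (lintegral_congr fun x => ?_)) h1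
    rw [ENNReal.mul_rpow_of_nonneg _ _ hr0.le, eLpNorm_rpow_toReal hp0 hpt,
      ← lintegral_const_mul' _ _ (ENNReal.rpow_ne_top_of_nonneg hr0.le enorm_ne_top)]
    refine lintegral_congr fun ξ => ?_
    rw [enorm_mul, ENNReal.mul_rpow_of_nonneg _ _ hr0.le]
  set D := ∫⁻ y, ‖η y‖ₑ ^ r with hD
  have hD0 : D ≠ 0 := by
    obtain ⟨t₀, ht₀⟩ := exists_apply_ne_zero hh
    have ho : IsOpen {y | η y ≠ 0} := isOpen_ne_fun hηc continuous_const
    have hne : {y | η y ≠ 0}.Nonempty := ⟨t₀, by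
      simp only [hη, Set.mem_ofPred_eq, ne_eq, Complex.ofReal_eq_zero]
      exact div_ne_zero (pow_ne_zero _ (norm_ne_zero_iff.2 ht₀)) (polyWeight_pos s t₀).ne'⟩
    refine ((lintegral_pos_iff_support (hηc.enorm.measurable.pow_const _)).2
      ((ho.measure_pos volume hne).trans_le (measure_mono fun y hy => ?_))).ne'
    simpa [Function.mem_support, ENNReal.rpow_eq_zero_iff, hr0, hr0.not_gt] using hy
  have hFm : AEMeasurable (fun t => ‖(polyWeight s t : ℂ) * F t‖ₑ) volume :=
    (hwc.aestronglyMeasurable.mul hF.1).enorm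
  -- integrating the local bounds over `x` produces the factor `D`, of which only positivity matters
  have htot : (∫⁻ t, ‖(polyWeight s t : ℂ) * F t‖ₑ ^ r) * D < ⊤ := by
    have hjm : AEMeasurable (Function.uncurry fun t x : V =>
        (‖(polyWeight s t : ℂ) * F t‖ₑ * ‖η (t - x)‖ₑ) ^ r) (volume.prod volume) := by
      refine AEMeasurable.pow_const (AEMeasurable.mul hFm.comp_fst ?_) _
      exact (hηc.comp (continuous_fst.sub continuous_snd)).enorm.measurable.aemeasurable
    calc (∫⁻ t, ‖(polyWeight s t : ℂ) * F t‖ₑ ^ r) * D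
        ≤ ∫⁻ t, ‖(polyWeight s t : ℂ) * F t‖ₑ ^ r * D := lintegral_mul_const_le _ _
      _ = ∫⁻ t, ∫⁻ x, (‖(polyWeight s t : ℂ) * F t‖ₑ * ‖η (t - x)‖ₑ) ^ r := by
          refine lintegral_congr fun t => ?_
          simp only [ENNReal.mul_rpow_of_nonneg _ _ hr0.le]
          rw [lintegral_const_mul' _ _ (ENNReal.rpow_ne_top_of_nonneg hr0.le enorm_ne_top),
            lintegral_sub_left_eq_self (fun y => ‖η y‖ₑ ^ r) t]
      _ = ∫⁻ x, ∫⁻ t, (‖(polyWeight s t : ℂ) * F t‖ₑ * ‖η (t - x)‖ₑ) ^ r :=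
          lintegral_lintegral_swap hjm
      _ ≤ ∫⁻ x, (‖(c : ℂ)‖ₑ * eLpNorm h q volume * C) ^ r * (‖(polyWeight s x : ℂ)‖ₑ * B x) ^ r :=
          lintegral_mono hinner
      _ < ⊤ := by
          have hcst : (‖(c : ℂ)‖ₑ * eLpNorm h q volume * C) ^ r ≠ ⊤ :=
            ENNReal.rpow_ne_top_of_nonneg hr0.le (ENNReal.mul_ne_top
              (ENNReal.mul_ne_top enorm_ne_top (eLpNorm_schwartz_ne_top h q)) hC)
          rw [lintegral_const_mul' _ _ hcst]
          exact ENNReal.mul_lt_top hcst.lt_top hB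
  rw [eLpNorm_lt_top_iff_lintegral_rpow_enorm_lt_top hp0 hpt]
  by_contra hcon
  rw [not_lt, top_le_iff] at hcon
  rw [hcon, ENNReal.top_mul hD0] at htot
  exact lt_irrefl _ htot

end WeightedLp

/-! ### Unitarity and covariance of metaplectic operators -/

section Metaplectic

open FourierTransform ComplexConjugate

variable {ι : Type} [Fintype ι]

theorem posPart_apply (z : RSp (ι ⊕ ι)) (i : ι) : posPart z i = z (Sum.inl i) := rfl

theorem freqPart_apply (z : RSp (ι ⊕ ι)) (i : ι) : freqPart z i = z (Sum.inr i) := rfl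

theorem inner_toLp_mulVec_transpose (L : Matrix ι ι ℝ) (x y : RSp ι) :
    inner ℝ (WithLp.toLp 2 (L.transpose.mulVec x.ofLp) : RSp ι) y
      = inner ℝ x (WithLp.toLp 2 (L.mulVec y.ofLp)) := by
  simp only [EuclideanSpace.inner_eq_star_dotProduct, star_trivial]
  rw [Matrix.mulVec_transpose, dotProduct_comm, ← Matrix.dotProduct_mulVec, dotProduct_comm]

theorem posPart_fromBlocks (A B C D : Matrix ι ι ℝ) (z : RSp (ι ⊕ ι)) :
    posPart (WithLp.toLp 2 ((Matrix.fromBlocks A B C D).mulVec z.ofLp))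
      = WithLp.toLp 2 (A.mulVec (posPart z).ofLp + B.mulVec (freqPart z).ofLp) := by
  ext i
  rw [posPart_apply]
  simp only [Matrix.fromBlocks_mulVec, Sum.elim_inl]
  rfl

theorem freqPart_fromBlocks (A B C D : Matrix ι ι ℝ) (z : RSp (ι ⊕ ι)) :
    freqPart (WithLp.toLp 2 ((Matrix.fromBlocks A B C D).mulVec z.ofLp))
      = WithLp.toLp 2 (C.mulVec (posPart z).ofLp + D.mulVec (freqPart z).ofLp) := by
  ext i
  rw [freqPart_apply]
  simp only [Matrix.fromBlocks_mulVec, Sum.elim_inr]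
  rfl

variable [DecidableEq ι]

/-- A matrix with invertible determinant, as an automorphism of Euclidean space. -/
noncomputable def mulVecEquiv (B : Matrix ι ι ℝ) (hB : IsUnit B.det) : RSp ι ≃L[ℝ] RSp ι :=
  (LinearEquiv.ofIsUnitDet (f := B.toLpLin 2 2) (v := (EuclideanSpace.basisFun ι ℝ).toBasis)
    (v' := (EuclideanSpace.basisFun ι ℝ).toBasis) (by
      rw [LinearMap.det_toMatrix, LinearMap.det_toLpLin]; exact hB)).toContinuousLinearEquiv

theorem mulVecEquiv_apply (B : Matrix ι ι ℝ) (hB : IsUnit B.det) (x : RSp ι) :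
    mulVecEquiv B hB x = WithLp.toLp 2 (B.mulVec x.ofLp) := rfl

theorem integral_comp_mulVec (L : Matrix ι ι ℝ) (hL : IsUnit L.det) (G : RSp ι → ℂ) :
    ((|L.det| : ℝ) : ℂ) * ∫ x : RSp ι, G (WithLp.toLp 2 (L.mulVec x.ofLp)) = ∫ x, G x := by
  have hd : LinearMap.det (L.toLpLin 2 2) ≠ 0 := by
    rw [LinearMap.det_toLpLin]; exact hL.ne_zero
  have h1 : Measure.map (L.toLpLin 2 2) (volume : Measure (RSp ι))
      = ENNReal.ofReal |L.det⁻¹| • volume := by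
    rw [Measure.map_linearMap_addHaar_eq_smul_addHaar _ hd, LinearMap.det_toLpLin]
  have h2 : ∫ x : RSp ι, G (L.toLpLin 2 2 x) = ∫ y, G y ∂(Measure.map (L.toLpLin 2 2) volume) :=
    (integral_map_equiv (mulVecEquiv L hL).toHomeomorph.toMeasurableEquiv G).symm
  have h3 : ∫ x : RSp ι, G (WithLp.toLp 2 (L.mulVec x.ofLp)) = ∫ x : RSp ι, G (L.toLpLin 2 2 x) := rfl
  rw [h3, h2, h1, integral_smul_measure, ENNReal.toReal_ofReal (abs_nonneg _)]
  have hne : |L.det| ≠ 0 := abs_ne_zero.2 hL.ne_zero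
  rw [abs_inv, Complex.real_smul, ← mul_assoc, ← Complex.ofReal_mul, mul_inv_cancel₀ hne]
  simp

/-- Metaplectic operators preserve the `L²` inner product. -/
theorem IsMetaplectic.integral_mul_conj {A : Matrix (ι ⊕ ι) (ι ⊕ ι) ℝ}
    {U : 𝓢(RSp ι, ℂ) ≃L[ℂ] 𝓢(RSp ι, ℂ)} (hU : IsMetaplectic A U) :
    ∀ φ ψ : 𝓢(RSp ι, ℂ), ∫ x, U φ x * conj (U ψ x) = ∫ x, φ x * conj (ψ x) := by
  induction hU with
  | phase c hc U hU =>
    intro φ ψ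
    refine integral_congr_ae (ae_of_all _ fun x => ?_)
    have : c * conj c = 1 := by
      rw [Complex.mul_conj, Complex.normSq_eq_norm_sq, hc]; simp
    simp only [hU, map_mul]
    linear_combination (φ x * conj (ψ x)) * this
  | fourier U hU =>
    intro φ ψ
    have h := integral_inner_fourier_fourier ψ φ
    simpa only [hU, fourier_coe, RCLike.inner_apply] using h
  | dilation L hL U hU =>
    intro φ ψ
    rw [← integral_comp_mulVec L hL (fun x => φ x * conj (ψ x)), ← integral_const_mul]
    refine integral_congr_ae (ae_of_all _ fun x => ?_)
    have : (Real.sqrt |L.det| : ℂ) * (Real.sqrt |L.det| : ℂ) = ((|L.det| : ℝ) : ℂ) := by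
      rw [← Complex.ofReal_mul, Real.mul_self_sqrt (abs_nonneg _)]
    simp only [hU, map_mul, Complex.conj_ofReal]
    rw [← this]
    ring
  | chirp C hC U hU =>
    intro φ ψ
    refine integral_congr_ae (ae_of_all _ fun x => ?_)
    simp only [hU, map_mul]
    set r : ℝ := dotProduct (C.mulVec x.ofLp) x.ofLp
    have : Complex.exp (Complex.I * Real.pi * (r : ℝ))
        * conj (Complex.exp (Complex.I * Real.pi * (r : ℝ)))
        = 1 := by
      rw [Complex.mul_conj, Complex.normSq_eq_norm_sq,
        show (Complex.I * Real.pi * (r : ℝ) : ℂ) = ((Real.pi * r : ℝ) : ℂ) * Complex.I by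
          push_cast; ring, Complex.norm_exp_ofReal_mul_I]
      simp
    linear_combination (φ x * conj (ψ x)) * this
  | comp hU hV ihU ihV =>
    intro φ ψ
    simp only [ContinuousLinearEquiv.trans_apply]
    rw [ihU, ihV]
  | inv hU ih =>
    rename_i U
    intro φ ψ
    rw [← ih]
    simp only [ContinuousLinearEquiv.apply_symm_apply]

/-- The projection of a metaplectic operator is invertible, and describes the conjugation of
time-frequency shifts by the operator, up to unimodular constants. -/
theorem IsMetaplectic.tfShift_comm {A : Matrix (ι ⊕ ι) (ι ⊕ ι) ℝ}
    {U : 𝓢(RSp ι, ℂ) ≃L[ℂ] 𝓢(RSp ι, ℂ)} (hU : IsMetaplectic A U) :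
    IsUnit A.det ∧ ∀ (z : RSp (ι ⊕ ι)) (φ : 𝓢(RSp ι, ℂ)), ∃ c : ℂ, ‖c‖ = 1 ∧
      tfShiftSchwartz (WithLp.toLp 2 (A.mulVec z.ofLp)) (U φ) = c • U (tfShiftSchwartz z φ) := by
  induction hU with
  | phase c hc U hU =>
    refine ⟨by simp, fun z φ => ⟨1, by simp, ?_⟩⟩
    ext t
    simp only [Matrix.one_mulVec, tfShiftSchwartz_apply, tfShift, hU, one_smul]
    simp only [WithLp.toLp_ofLp]
    ring
  | fourier U hU =>
    refine ⟨Matrix.isUnit_det_of_right_inverse (B := Matrix.fromBlocks 0 (-1) 1 0)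
      (by simp [Matrix.fromBlocks_multiply]), fun z φ =>
      ⟨Complex.exp (2 * Real.pi * Complex.I * (-inner ℝ (freqPart z) (posPart z) : ℝ)),
        norm_cexp_two_pi_I _, ?_⟩⟩
    have hp : posPart (WithLp.toLp 2
        ((Matrix.fromBlocks 0 1 (-1) 0 : Matrix (ι ⊕ ι) (ι ⊕ ι) ℝ).mulVec z.ofLp))
        = freqPart z := by
      rw [posPart_fromBlocks]; simp
    have hf : freqPart (WithLp.toLp 2
        ((Matrix.fromBlocks 0 1 (-1) 0 : Matrix (ι ⊕ ι) (ι ⊕ ι) ℝ).mulVec z.ofLp))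
        = -posPart z := by
      rw [freqPart_fromBlocks]; simp [Matrix.neg_mulVec]
    ext t
    rw [smul_apply, hU, tfShiftSchwartz_apply, tfShift, hp, hf, hU, Real.fourier_eq', Real.fourier_eq',
      ← integral_const_mul, smul_eq_mul, ← integral_const_mul,
      ← integral_sub_right_eq_self _ (posPart z)]
    refine integral_congr_ae (ae_of_all _ fun v => ?_)
    simp only [tfShiftSchwartz_apply, tfShift, smul_eq_mul]
    simp only [← mul_assoc, ← Complex.exp_add]
    congr 2
    simp only [inner_sub_left, inner_sub_right, inner_neg_left, real_inner_comm]
    push_cast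
    ring
  | dilation L hL U hU =>
    refine ⟨?_, fun z φ => ⟨1, by simp, ?_⟩⟩
    · rw [Matrix.det_fromBlocks_zero₂₁, Matrix.det_transpose]
      exact (L.isUnit_nonsing_inv_det hL).mul hL
    have hp : posPart (WithLp.toLp 2 ((Matrix.fromBlocks L⁻¹ 0 0 L.transpose).mulVec z.ofLp))
        = WithLp.toLp 2 (L⁻¹.mulVec (posPart z).ofLp) := by
      rw [posPart_fromBlocks]; simp
    have hf : freqPart (WithLp.toLp 2 ((Matrix.fromBlocks L⁻¹ 0 0 L.transpose).mulVec z.ofLp))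
        = WithLp.toLp 2 (L.transpose.mulVec (freqPart z).ofLp) := by
      rw [freqPart_fromBlocks]; simp
    ext t
    rw [one_smul, hU, tfShiftSchwartz_apply, tfShiftSchwartz_apply, tfShift, tfShift, hp, hf, hU,
      inner_toLp_mulVec_transpose]
    have : (WithLp.toLp 2 (L.mulVec (t - WithLp.toLp 2 (L⁻¹.mulVec (posPart z).ofLp)).ofLp) : RSp ι)
        = WithLp.toLp 2 (L.mulVec t.ofLp) - posPart z := by
      rw [WithLp.ofLp_sub, Matrix.mulVec_sub, Matrix.mulVec_mulVec, L.mul_nonsing_inv hL,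
        Matrix.one_mulVec]
      rfl
    rw [this]
    ring
  | chirp C hC U hU =>
    refine ⟨by simp, fun z φ => ⟨Complex.exp (Complex.I * Real.pi *
      (dotProduct (C.mulVec (posPart z).ofLp) (posPart z).ofLp : ℝ)), ?_, ?_⟩⟩
    · set r : ℝ := dotProduct (C.mulVec (posPart z).ofLp) (posPart z).ofLp
      rw [show (Complex.I * Real.pi * (r : ℝ) : ℂ) = ((Real.pi * r : ℝ) : ℂ) * Complex.I by
          push_cast; ring, Complex.norm_exp_ofReal_mul_I]
    have hp : posPart (WithLp.toLp 2 ((Matrix.fromBlocks 1 0 C 1).mulVec z.ofLp)) = posPart z := by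
      rw [posPart_fromBlocks]; simp
    have hf : freqPart (WithLp.toLp 2 ((Matrix.fromBlocks 1 0 C 1).mulVec z.ofLp))
        = WithLp.toLp 2 (C.mulVec (posPart z).ofLp) + freqPart z := by
      rw [freqPart_fromBlocks]; simp
    ext t
    rw [smul_apply, hU, tfShiftSchwartz_apply, tfShiftSchwartz_apply, tfShift, tfShift, hp, hf, hU,
      smul_eq_mul]
    simp only [← mul_assoc, ← Complex.exp_add]
    congr 2
    have e1 : inner ℝ (WithLp.toLp 2 (C.mulVec (posPart z).ofLp) : RSp ι) t
        = dotProduct (C.mulVec (posPart z).ofLp) t.ofLp := by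
      simp only [EuclideanSpace.inner_eq_star_dotProduct, star_trivial]
      rw [dotProduct_comm]
    have e2 : dotProduct (C.mulVec t.ofLp) (posPart z).ofLp
        = dotProduct (C.mulVec (posPart z).ofLp) t.ofLp := by
      rw [dotProduct_comm, Matrix.dotProduct_mulVec, ← Matrix.mulVec_transpose, hC.eq]
    rw [inner_add_left, e1, WithLp.ofLp_sub, Matrix.mulVec_sub]
    simp only [sub_dotProduct, dotProduct_sub, e2]
    push_cast
    ring
  | comp hU hV ihU ihV =>
    rename_i A B U V
    refine ⟨?_, fun z φ => ?_⟩
    · rw [Matrix.det_mul]; exact ihU.1.mul ihV.1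
    obtain ⟨c, hc, h1⟩ := ihV.2 z φ
    obtain ⟨c', hc', h2⟩ := ihU.2 (WithLp.toLp 2 (B.mulVec z.ofLp)) (V φ)
    refine ⟨c' * c, by rw [norm_mul, hc, hc', one_mul], ?_⟩
    rw [Matrix.mulVec_mulVec] at h2
    simp only [ContinuousLinearEquiv.trans_apply]
    rw [h2, h1, map_smul, smul_smul]
  | inv hU ih =>
    rename_i A U
    refine ⟨A.isUnit_nonsing_inv_det ih.1, fun z φ => ?_⟩
    obtain ⟨c, hc, h⟩ := ih.2 (WithLp.toLp 2 (A⁻¹.mulVec z.ofLp)) (U.symm φ)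
    rw [Matrix.mulVec_mulVec, A.mul_nonsing_inv ih.1, Matrix.one_mulVec,
      ContinuousLinearEquiv.apply_symm_apply] at h
    have hc0 : c ≠ 0 := by rintro rfl; simp at hc
    refine ⟨c⁻¹, by rw [norm_inv, hc, inv_one], ?_⟩
    rw [WithLp.toLp_ofLp] at h
    rw [h, map_smul, ContinuousLinearEquiv.symm_apply_apply, smul_smul, inv_mul_cancel₀ hc0, one_smul]

end Metaplectic

/-! ### Wigner distributions of functions -/

section WignerSchwartz

open ComplexConjugate

variable {ι κ : Type} [Fintype ι] [Fintype κ]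

theorem measurePreserving_sumEquivProd :
    MeasurePreserving (EuclideanSpace.sumEquivProd (𝕜 := ℝ) (ι := ι) (κ := κ)) volume volume := by
  have h1 := PiLp.volume_preserving_ofLp (ι ⊕ κ)
  have h2 := volume_measurePreserving_sumPiEquivProdPi (fun _ : ι ⊕ κ => ℝ)
  have h3 := (PiLp.volume_preserving_toLp ι).prod (PiLp.volume_preserving_toLp κ)
  exact h3.comp (h2.comp h1)

theorem integral_sumEquivProd (G : RSp ι × RSp κ → ℂ) :
    ∫ z : RSp (ι ⊕ κ), G (EuclideanSpace.sumEquivProd (𝕜 := ℝ) z) = ∫ w, G w :=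
  measurePreserving_sumEquivProd.integral_comp
    (EuclideanSpace.sumEquivProd (𝕜 := ℝ) (ι := ι) (κ := κ)).toHomeomorph.measurableEmbedding G

/-- The tensor product of two Schwartz functions, on the Euclidean space of the joint coordinates. -/
noncomputable def tensorRSp (a : 𝓢(RSp ι, ℂ)) (b : 𝓢(RSp κ, ℂ)) : 𝓢(RSp (ι ⊕ κ), ℂ) :=
  compCLMOfContinuousLinearEquiv ℂ (EuclideanSpace.sumEquivProd (𝕜 := ℝ)) (schwartzTensor a b)

theorem tensorRSp_apply (a : 𝓢(RSp ι, ℂ)) (b : 𝓢(RSp κ, ℂ)) (z : RSp (ι ⊕ κ)) :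
    tensorRSp a b z = a (EuclideanSpace.sumEquivProd (𝕜 := ℝ) z).1
      * b (EuclideanSpace.sumEquivProd (𝕜 := ℝ) z).2 := rfl

theorem schwartzConj_schwartzConj {V : Type} [NormedAddCommGroup V] [NormedSpace ℝ V]
    (φ : 𝓢(V, ℂ)) : schwartzConj (schwartzConj φ) = φ := by
  ext x
  simp only [schwartzConj_apply, Complex.conj_conj]

theorem schwartzConj_tensorRSp (a : 𝓢(RSp ι, ℂ)) (b : 𝓢(RSp κ, ℂ)) :
    schwartzConj (tensorRSp a b) = tensorRSp (schwartzConj a) (schwartzConj b) := by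
  ext z
  simp only [schwartzConj_apply, tensorRSp_apply, map_mul]

theorem tensorRSp_ne_zero {a : 𝓢(RSp ι, ℂ)} {b : 𝓢(RSp κ, ℂ)} (ha : a ≠ 0) (hb : b ≠ 0) :
    tensorRSp a b ≠ 0 := by
  obtain ⟨x, hx⟩ := exists_apply_ne_zero ha
  obtain ⟨y, hy⟩ := exists_apply_ne_zero hb
  intro h0
  have h1 := DFunLike.congr_fun h0 ((EuclideanSpace.sumEquivProd (𝕜 := ℝ)).symm (x, y))
  rw [tensorRSp_apply, ContinuousLinearEquiv.apply_symm_apply] at h1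
  exact mul_ne_zero hx hy h1

theorem tensorDistrib_tensorRSp (S : 𝓢'(RSp ι, ℂ)) (T : 𝓢'(RSp κ, ℂ)) (a : 𝓢(RSp ι, ℂ))
    (b : 𝓢(RSp κ, ℂ)) : tensorDistrib S T (tensorRSp a b) = S a * T b := by
  let T' : 𝓢(RSp κ, ℂ) →L[ℂ] ℂ := ⟨T.toLinearMap, T.continuous⟩
  have h : partialPairing T' (compCLMOfContinuousLinearEquiv ℂ
      (EuclideanSpace.sumEquivProd (𝕜 := ℝ) (ι := ι) (κ := κ)).symm (tensorRSp a b)) = T b • a := by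
    ext x
    rw [partialPairing_apply]
    have : sliceCLM x (compCLMOfContinuousLinearEquiv ℂ
        (EuclideanSpace.sumEquivProd (𝕜 := ℝ) (ι := ι) (κ := κ)).symm (tensorRSp a b)) = a x • b := by
      ext y
      rw [sliceCLM_apply, compCLMOfContinuousLinearEquiv_apply, Function.comp_apply,
        tensorRSp_apply, ContinuousLinearEquiv.apply_symm_apply]
      rfl
    rw [this, map_smul, smul_apply, smul_eq_mul, smul_eq_mul, mul_comm]
    rfl
  change S (partialPairing T' _) = _
  rw [h, map_smul, smul_eq_mul, mul_comm]

theorem conjDistrib_apply {V : Type} [NormedAddCommGroup V] [NormedSpace ℝ V] (T : 𝓢'(V, ℂ))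
    (φ : 𝓢(V, ℂ)) : conjDistrib T φ = conj (T (schwartzConj φ)) := rfl

theorem integrable_schwartz_prod {X Y : Type} [NormedAddCommGroup X] [NormedSpace ℝ X]
    [FiniteDimensional ℝ X] [MeasurableSpace X] [BorelSpace X] [NormedAddCommGroup Y]
    [NormedSpace ℝ Y] [FiniteDimensional ℝ Y] [MeasurableSpace Y] [BorelSpace Y] (μ : Measure X)
    [μ.IsAddHaarMeasure] (ν : Measure Y) [ν.IsAddHaarMeasure] (θ : 𝓢(X × Y, ℂ)) :
    Integrable θ (μ.prod ν) :=
  θ.integrable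

/-- The tensor product of the distributions given by Schwartz functions is given by their tensor
product. -/
theorem tensorDistrib_of_integral (S : 𝓢'(RSp ι, ℂ)) (T : 𝓢'(RSp κ, ℂ)) (a : 𝓢(RSp ι, ℂ))
    (b : 𝓢(RSp κ, ℂ)) (hS : ∀ φ : 𝓢(RSp ι, ℂ), S φ = ∫ x, φ x * a x)
    (hT : ∀ φ : 𝓢(RSp κ, ℂ), T φ = ∫ y, φ y * b y) (θ : 𝓢(RSp (ι ⊕ κ), ℂ)) :
    tensorDistrib S T θ = ∫ z, θ z * tensorRSp a b z := by
  let T' : 𝓢(RSp κ, ℂ) →L[ℂ] ℂ := ⟨T.toLinearMap, T.continuous⟩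
  let θ' : 𝓢(RSp ι × RSp κ, ℂ) := compCLMOfContinuousLinearEquiv ℂ
    (EuclideanSpace.sumEquivProd (𝕜 := ℝ) (ι := ι) (κ := κ)).symm θ
  have e : ∀ z, θ z * tensorRSp a b z
      = (fun w : RSp ι × RSp κ => θ' w * (a w.1 * b w.2)) (EuclideanSpace.sumEquivProd (𝕜 := ℝ) z) := by
    intro z
    simp only [θ', compCLMOfContinuousLinearEquiv_apply, Function.comp_apply,
      ContinuousLinearEquiv.symm_apply_apply]
    rfl
  rw [integral_congr_ae (ae_of_all _ e),
    integral_sumEquivProd (fun w : RSp ι × RSp κ => θ' w * (a w.1 * b w.2)),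
    Measure.volume_eq_prod, integral_prod]
  · change S (partialPairing T' θ') = _
    rw [hS]
    refine integral_congr_ae (ae_of_all _ fun x => ?_)
    have h1 : partialPairing T' θ' x = ∫ y, θ' (x, y) * b y := hT (sliceCLM x θ')
    simp only [h1]
    rw [← integral_mul_const]
    refine integral_congr_ae (ae_of_all _ fun y => ?_)
    simp only
    ring
  · have hg : Function.HasTemperateGrowth (θ' : RSp ι × RSp κ → ℂ) := θ'.hasTemperateGrowth
    have h2 := integrable_schwartz_prod (volume : Measure (RSp ι)) (volume : Measure (RSp κ))
      (smulLeftCLM ℂ (θ' : RSp ι × RSp κ → ℂ) (schwartzTensor a b))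
    refine h2.congr (ae_of_all _ fun w => ?_)
    rw [smulLeftCLM_apply_apply hg]
    rfl

variable (U : 𝓢(RSp (ι ⊕ ι), ℂ) ≃L[ℂ] 𝓢(RSp (ι ⊕ ι), ℂ))

/-- The unitarity of the extension of `U` to distributions, in the form in which `W_A` is tested. -/
theorem wignerDistrib_schwartzConj (f h : 𝓢'(RSp ι, ℂ)) (Ψ : 𝓢(RSp (ι ⊕ ι), ℂ)) :
    wignerDistrib U f h (schwartzConj (U Ψ)) = tensorDistrib f (conjDistrib h) (schwartzConj Ψ) := by
  change tensorDistrib f (conjDistrib h)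
    (schwartzConj (U.symm (schwartzConj (schwartzConj (U Ψ))))) = _
  rw [schwartzConj_schwartzConj, ContinuousLinearEquiv.symm_apply_apply]

variable [DecidableEq ι]

/-- On Schwartz functions, `W_A` is the function `U (a ⊗ b̄)`, where `U = μ(A)`. -/
theorem wignerDistrib_of_integral {A : Matrix ((ι ⊕ ι) ⊕ (ι ⊕ ι)) ((ι ⊕ ι) ⊕ (ι ⊕ ι)) ℝ}
    (hU : IsMetaplectic A U) (S T : 𝓢'(RSp ι, ℂ)) (a b : 𝓢(RSp ι, ℂ))
    (hS : ∀ φ : 𝓢(RSp ι, ℂ), S φ = ∫ x, φ x * a x)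
    (hT : ∀ φ : 𝓢(RSp ι, ℂ), T φ = ∫ y, φ y * b y) (φ : 𝓢(RSp (ι ⊕ ι), ℂ)) :
    wignerDistrib U S T φ = ∫ z, φ z * U (tensorRSp a (schwartzConj b)) z := by
  have hT' : ∀ φ : 𝓢(RSp ι, ℂ), conjDistrib T φ = ∫ y, φ y * schwartzConj b y := by
    intro φ
    rw [conjDistrib_apply, hT, ← integral_conj]
    simp only [schwartzConj_apply, map_mul, Complex.conj_conj]
  set Ψ := U.symm (schwartzConj φ) with hΨ
  have h1 : φ = schwartzConj (U Ψ) := by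
    rw [hΨ, ContinuousLinearEquiv.apply_symm_apply, schwartzConj_schwartzConj]
  rw [h1, wignerDistrib_schwartzConj, tensorDistrib_of_integral S _ a (schwartzConj b) hS hT']
  have h2 := hU.integral_mul_conj (tensorRSp a (schwartzConj b)) Ψ
  simp only [schwartzConj_apply]
  simp only [mul_comm (conj _)]
  exact h2.symm

end WignerSchwartz

/-! ### Weighted `L^p` norms of products after a linear change of variables -/

section WeightedProduct

theorem lintegral_comp_equiv_lt_top {X Y : Type} [NormedAddCommGroup X] [NormedSpace ℝ X]
    [FiniteDimensional ℝ X] [MeasurableSpace X] [BorelSpace X] [NormedAddCommGroup Y]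
    [NormedSpace ℝ Y] [FiniteDimensional ℝ Y] [MeasurableSpace Y] [BorelSpace Y] (L : X ≃L[ℝ] Y)
    (μ : Measure X) [μ.IsAddHaarMeasure] (ν : Measure Y) [ν.IsAddHaarMeasure] {K : Y → ℝ≥0∞}
    (h : ∫⁻ y, K y ∂ν < ⊤) : ∫⁻ x, K (L x) ∂μ < ⊤ := by
  have h1 : (Measure.map L μ).IsAddHaarMeasure := L.isAddHaarMeasure_map μ
  have h2 := Measure.isAddLeftInvariant_eq_smul (Measure.map L μ) ν
  have h3 : ∫⁻ x, K (L x) ∂μ = ∫⁻ y, K y ∂(Measure.map L μ) :=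
    (lintegral_map_equiv K L.toHomeomorph.toMeasurableEquiv).symm
  rw [h3, h2, lintegral_smul_measure]
  exact ENNReal.mul_lt_top ENNReal.coe_lt_top h

variable {V X Y : Type} [NormedAddCommGroup V] [NormedSpace ℝ V]
  [FiniteDimensional ℝ V] [MeasurableSpace V] [BorelSpace V]
  [NormedAddCommGroup X] [NormedSpace ℝ X]
  [FiniteDimensional ℝ X] [MeasurableSpace X] [BorelSpace X] [NormedAddCommGroup Y]
  [NormedSpace ℝ Y] [FiniteDimensional ℝ Y] [MeasurableSpace Y] [BorelSpace Y]

/-- A function dominated, after a linear change of variables, by a tensor product of functions in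
`L^p_{v_s}` is in `L^p` with the weight `v_s` in its first variable, as
`v_s(z₁) ≤ C v_s(x) v_s(y)` for `(x, y) = L z`. -/
theorem memLp_weight_of_le_mul (L : (V × V) ≃L[ℝ] (X × Y)) (μ : Measure V) [μ.IsAddHaarMeasure]
    (ν : Measure X) [ν.IsAddHaarMeasure] (ρ : Measure Y) [ρ.IsAddHaarMeasure]
    {p : ℝ≥0∞} (hp1 : 1 ≤ p) (hp2 : p ≠ ⊤) {s : ℝ} (hs : 0 ≤ s) {P : X → ℂ} {Q : Y → ℂ}
    (hP : MemLp (fun x => (polyWeight s x : ℂ) * P x) p ν)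
    (hQ : MemLp (fun y => (polyWeight s y : ℂ) * Q y) p ρ) {H : V × V → ℂ} (hH : Continuous H)
    (hle : ∀ z, ‖H z‖ ≤ ‖P (L z).1‖ * ‖Q (L z).2‖) :
    MemLp (fun z : V × V => (polyWeight s z.1 : ℂ) * H z) p (μ.prod μ) := by
  have hp0 : p ≠ 0 := (zero_lt_one.trans_le hp1).ne'
  set r := p.toReal with hr
  have hr0 : 0 < r := ENNReal.toReal_pos hp0 hp2
  have hc : Continuous fun z : V × V => (polyWeight s z.1 : ℂ) * H z :=
    (Complex.continuous_ofReal.comp ((continuous_polyWeight s).comp continuous_fst)).mul hH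
  refine ⟨hc.aestronglyMeasurable, ?_⟩
  rw [eLpNorm_lt_top_iff_lintegral_rpow_enorm_lt_top hp0 hp2]
  set D := max 1 ‖(L.symm : X × Y →L[ℝ] V × V)‖ with hD
  set c : ℝ := (2 * D ^ 2) ^ (s / 2) with hcdef
  have hc0 : 0 ≤ c := by positivity
  set p1 : X → ℂ := fun x => (polyWeight s x : ℂ) * P x with hp1'
  set q1 : Y → ℂ := fun y => (polyWeight s y : ℂ) * Q y with hq1'
  have hpt : ∀ z, ‖(polyWeight s z.1 : ℂ) * H z‖ₑ
      ≤ ‖(c : ℂ)‖ₑ * (‖p1 (L z).1‖ₑ * ‖q1 (L z).2‖ₑ) := by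
    intro z
    rw [← enorm_mul, ← enorm_mul, enorm_le_iff_norm_le]
    have h1 : ‖z.1‖ ≤ D * (‖(L z).1‖ + ‖(L z).2‖) := by
      calc ‖z.1‖ ≤ ‖z‖ := norm_fst_le z
        _ = ‖(L.symm : X × Y →L[ℝ] V × V) (L z)‖ := by simp
        _ ≤ ‖(L.symm : X × Y →L[ℝ] V × V)‖ * ‖L z‖ := ContinuousLinearMap.le_opNorm _ _
        _ ≤ D * (‖(L z).1‖ + ‖(L z).2‖) := by
            gcongr
            · exact le_max_right _ _
            · exact max_le_add_of_nonneg (norm_nonneg _) (norm_nonneg _)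
    have h2 := polyWeight_le_mul hs (le_max_left _ _) h1
    simp only [p1, q1, norm_mul, Complex.norm_real, Real.norm_of_nonneg hc0,
      Real.norm_of_nonneg (polyWeight_pos s _).le]
    calc _ ≤ (c * (polyWeight s (L z).1 * polyWeight s (L z).2))
          * (‖P (L z).1‖ * ‖Q (L z).2‖) :=
          mul_le_mul h2 (hle z) (norm_nonneg _)
            (mul_nonneg hc0 (mul_nonneg (polyWeight_pos s _).le (polyWeight_pos s _).le))
      _ = _ := by ring
  have hK : ∫⁻ w : X × Y, ‖(c : ℂ)‖ₑ ^ r * (‖p1 w.1‖ₑ ^ r * ‖q1 w.2‖ₑ ^ r) ∂(ν.prod ρ) < ⊤ := by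
    rw [lintegral_const_mul' _ _ (ENNReal.rpow_ne_top_of_nonneg hr0.le enorm_ne_top),
      lintegral_prod_mul (f := fun x => ‖p1 x‖ₑ ^ r) (g := fun y => ‖q1 y‖ₑ ^ r)
        (hP.1.enorm.pow_const _) (hQ.1.enorm.pow_const _)]
    exact ENNReal.mul_lt_top (ENNReal.rpow_lt_top_of_nonneg hr0.le enorm_ne_top)
      (ENNReal.mul_lt_top ((eLpNorm_lt_top_iff_lintegral_rpow_enorm_lt_top hp0 hp2).1 hP.2)
        ((eLpNorm_lt_top_iff_lintegral_rpow_enorm_lt_top hp0 hp2).1 hQ.2))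
  refine lt_of_le_of_lt (lintegral_mono fun z => ?_)
    (lintegral_comp_equiv_lt_top L (μ.prod μ) (ν.prod ρ) hK)
  calc _ ≤ (‖(c : ℂ)‖ₑ * (‖p1 (L z).1‖ₑ * ‖q1 (L z).2‖ₑ)) ^ r :=
        ENNReal.rpow_le_rpow (hpt z) hr0.le
    _ = _ := by simp only [ENNReal.mul_rpow_of_nonneg _ _ hr0.le]

end WeightedProduct

/-! ### Time-frequency shifts of tensor products -/

section ShortTime

open ComplexConjugate

variable {ι κ : Type} [Fintype ι] [Fintype κ]

theorem schwartzConj_tfShiftSchwartz (z : RSp (ι ⊕ ι)) (g : 𝓢(RSp ι, ℂ)) :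
    schwartzConj (tfShiftSchwartz z g) = atom (schwartzConj g) (posPart z) (freqPart z) := by
  ext t
  rw [schwartzConj_apply, tfShiftSchwartz_apply, tfShift, atom_apply, schwartzConj_apply, map_mul,
    ← Complex.exp_conj]
  congr 2
  simp only [map_mul, Complex.conj_I, Complex.conj_ofReal, Complex.conj_ofNat, inner_neg_left]
  push_cast
  ring

theorem continuous_stft (g : 𝓢(RSp ι, ℂ)) (f : 𝓢'(RSp ι, ℂ)) : Continuous (stft g f) := by
  let T : 𝓢(RSp ι, ℂ) →L[ℂ] ℂ := ⟨f.toLinearMap, f.continuous⟩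
  have h1 : Continuous fun z : RSp (ι ⊕ ι) => EuclideanSpace.sumEquivProd (𝕜 := ℝ) z :=
    ContinuousLinearEquiv.continuous _
  have h2 := (continuous_apply_atom T (schwartzConj g)).comp h1
  refine h2.congr fun z => ?_
  rw [stft, schwartzConj_tfShiftSchwartz]
  rfl

/-- The point `(x, ξ)` of phase space. -/
noncomputable def phasePoint (x ξ : RSp ι) : RSp (ι ⊕ ι) :=
  (EuclideanSpace.sumEquivProd (𝕜 := ℝ)).symm (x, ξ)

theorem posPart_phasePoint (x ξ : RSp ι) : posPart (phasePoint x ξ) = x := by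
  ext i; rfl

theorem freqPart_phasePoint (x ξ : RSp ι) : freqPart (phasePoint x ξ) = ξ := by
  ext i; rfl

theorem inner_sum (x y : RSp (ι ⊕ κ)) :
    inner ℝ x y = inner ℝ (EuclideanSpace.sumEquivProd (𝕜 := ℝ) x).1
        (EuclideanSpace.sumEquivProd (𝕜 := ℝ) y).1
      + inner ℝ (EuclideanSpace.sumEquivProd (𝕜 := ℝ) x).2
        (EuclideanSpace.sumEquivProd (𝕜 := ℝ) y).2 := by
  simp only [PiLp.inner_apply, Fintype.sum_sum_type]
  rfl

theorem tfShiftSchwartz_tensorRSp (z : RSp ((ι ⊕ ι) ⊕ (ι ⊕ ι))) (a b : 𝓢(RSp ι, ℂ)) :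
    tfShiftSchwartz z (tensorRSp a b)
      = tensorRSp (tfShiftSchwartz (phasePoint (posPart (posPart z)) (posPart (freqPart z))) a)
          (tfShiftSchwartz (phasePoint (freqPart (posPart z)) (freqPart (freqPart z))) b) := by
  ext t
  rw [tfShiftSchwartz_apply, tfShift, tensorRSp_apply, tensorRSp_apply, tfShiftSchwartz_apply,
    tfShiftSchwartz_apply, tfShift, tfShift, posPart_phasePoint, posPart_phasePoint,
    freqPart_phasePoint, freqPart_phasePoint, inner_sum, map_sub]
  have h1 : (EuclideanSpace.sumEquivProd (𝕜 := ℝ) (freqPart z)).1 = posPart (freqPart z) := rfl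
  have h2 : (EuclideanSpace.sumEquivProd (𝕜 := ℝ) (freqPart z)).2 = freqPart (freqPart z) := rfl
  have h3 : (EuclideanSpace.sumEquivProd (𝕜 := ℝ) (posPart z)).1 = posPart (posPart z) := rfl
  have h4 : (EuclideanSpace.sumEquivProd (𝕜 := ℝ) (posPart z)).2 = freqPart (posPart z) := rfl
  rw [Prod.fst_sub, Prod.snd_sub, h1, h2, h3, h4]
  rw [Complex.ofReal_add, mul_add, Complex.exp_add]
  ring

/-- Complex conjugation reflects the frequency of a time-frequency shift. -/
theorem schwartzConj_tfShiftSchwartz_schwartzConj (x ξ : RSp ι) (g : 𝓢(RSp ι, ℂ)) :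
    schwartzConj (tfShiftSchwartz (phasePoint x ξ) (schwartzConj g))
      = tfShiftSchwartz (phasePoint x (-ξ)) g := by
  rw [schwartzConj_tfShiftSchwartz, schwartzConj_schwartzConj, posPart_phasePoint,
    freqPart_phasePoint]
  ext t
  rw [atom_apply, tfShiftSchwartz_apply, tfShift, posPart_phasePoint, freqPart_phasePoint]

end ShortTime

/-! ### The short-time Fourier transform of a Wigner distribution -/

section WignerShortTime

open ComplexConjugate

variable {ι : Type} [Fintype ι] [DecidableEq ι]

/-- The change of variables `z ↦ (w₁, w₂)` on phase space for which the short-time Fourier transform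
of `W_A f` at `z` factors, up to a phase, into the short-time Fourier transforms of `f` at `w₁` and
(conjugated) at `w₂`: the point `A⁻¹ z`, read in the coordinates of the two tensor factors, with
the frequency of the second factor reflected. -/
noncomputable def wignerPhaseEquiv (A : Matrix ((ι ⊕ ι) ⊕ (ι ⊕ ι)) ((ι ⊕ ι) ⊕ (ι ⊕ ι)) ℝ)
    (hA : IsUnit A.det) :
    (RSp (ι ⊕ ι) × RSp (ι ⊕ ι)) ≃L[ℝ] (RSp (ι ⊕ ι) × RSp (ι ⊕ ι)) :=
  (EuclideanSpace.sumEquivProd (𝕜 := ℝ)).symm.trans <| (mulVecEquiv A hA).symm.trans <|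
  (EuclideanSpace.sumEquivProd (𝕜 := ℝ)).trans <|
  ((EuclideanSpace.sumEquivProd (𝕜 := ℝ)).prodCongr (EuclideanSpace.sumEquivProd (𝕜 := ℝ))).trans <|
  (ContinuousLinearEquiv.prodProdProdComm ℝ (RSp ι) (RSp ι) (RSp ι) (RSp ι)).trans <|
  ((ContinuousLinearEquiv.refl ℝ (RSp ι × RSp ι)).prodCongr
    ((ContinuousLinearEquiv.refl ℝ (RSp ι)).prodCongr (ContinuousLinearEquiv.neg ℝ))).trans <|
  (EuclideanSpace.sumEquivProd (𝕜 := ℝ)).symm.prodCongr (EuclideanSpace.sumEquivProd (𝕜 := ℝ)).symm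

theorem wignerPhaseEquiv_apply (A : Matrix ((ι ⊕ ι) ⊕ (ι ⊕ ι)) ((ι ⊕ ι) ⊕ (ι ⊕ ι)) ℝ)
    (hA : IsUnit A.det) (x ξ : RSp (ι ⊕ ι)) :
    wignerPhaseEquiv A hA (x, ξ) =
      (phasePoint (posPart (posPart ((mulVecEquiv A hA).symm (phasePoint x ξ))))
          (posPart (freqPart ((mulVecEquiv A hA).symm (phasePoint x ξ)))),
        phasePoint (freqPart (posPart ((mulVecEquiv A hA).symm (phasePoint x ξ))))
          (-freqPart (freqPart ((mulVecEquiv A hA).symm (phasePoint x ξ))))) := rfl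

variable {A : Matrix ((ι ⊕ ι) ⊕ (ι ⊕ ι)) ((ι ⊕ ι) ⊕ (ι ⊕ ι)) ℝ}
  {U : 𝓢(RSp (ι ⊕ ι), ℂ) ≃L[ℂ] 𝓢(RSp (ι ⊕ ι), ℂ)}

/-- The short-time Fourier transform of `W_A f` with window `W_A g` is, up to a phase and a linear
change of variables, a product of short-time Fourier transforms of `f` with window `g`. -/
theorem norm_wignerDistrib_atom (hU : IsMetaplectic A U) (g : 𝓢(RSp ι, ℂ)) (f : 𝓢'(RSp ι, ℂ))
    (z : RSp (ι ⊕ ι) × RSp (ι ⊕ ι)) :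
    ‖wignerDistrib U f f (atom (schwartzConj (U (tensorRSp g (schwartzConj g)))) z.1 z.2)‖
      = ‖stft g f (wignerPhaseEquiv A hU.tfShift_comm.1 z).1‖
        * ‖stft g f (wignerPhaseEquiv A hU.tfShift_comm.1 z).2‖ := by
  obtain ⟨x, ξ⟩ := z
  rw [wignerPhaseEquiv_apply]
  set y := (mulVecEquiv A hU.tfShift_comm.1).symm (phasePoint x ξ) with hy
  have hAy : (WithLp.toLp 2 (A.mulVec y.ofLp) : RSp ((ι ⊕ ι) ⊕ (ι ⊕ ι))) = phasePoint x ξ := by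
    rw [← mulVecEquiv_apply A hU.tfShift_comm.1, hy, ContinuousLinearEquiv.apply_symm_apply]
  obtain ⟨c, hc, h⟩ := hU.tfShift_comm.2 y (tensorRSp g (schwartzConj g))
  have h1 : atom (schwartzConj (U (tensorRSp g (schwartzConj g)))) x ξ
      = conj c • schwartzConj (U (tfShiftSchwartz y (tensorRSp g (schwartzConj g)))) := by
    rw [← map_smulₛₗ, ← h, hAy, schwartzConj_tfShiftSchwartz, posPart_phasePoint,
      freqPart_phasePoint]
  have h2 : ∀ w, f (tfShiftSchwartz w (schwartzConj g))
      = stft g f (phasePoint (posPart w) (-freqPart w)) := by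
    intro w
    rw [stft, ← schwartzConj_tfShiftSchwartz_schwartzConj, schwartzConj_schwartzConj]
    rfl
  rw [h1, map_smul, wignerDistrib_schwartzConj, tfShiftSchwartz_tensorRSp, schwartzConj_tensorRSp,
    tensorDistrib_tensorRSp, conjDistrib_apply, schwartzConj_schwartzConj, h2, posPart_phasePoint,
    freqPart_phasePoint, norm_smul, norm_mul, RCLike.norm_conj, RCLike.norm_conj, hc, one_mul]
  rfl

theorem schwartzConj_ne_zero {V : Type} [NormedAddCommGroup V] [NormedSpace ℝ V] {φ : 𝓢(V, ℂ)}
    (hφ : φ ≠ 0) : schwartzConj φ ≠ 0 := fun h =>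
  hφ (by rw [← schwartzConj_schwartzConj φ, h, map_zero])

/-- The window `W_A g` turns the hypothesis on `V_g f` into one on the short-time Fourier transform of
`W_A f`, to which `exists_memLp_weight_of_stft` applies. -/
theorem wignerDistrib_mem_weightedLp (hU : IsMetaplectic A U) {p : ℝ≥0∞} (hp1 : 1 ≤ p)
    (hp2 : p ≤ 2) {s : ℝ} (hs : 0 ≤ s) {g : 𝓢(RSp ι, ℂ)} (hg : g ≠ 0) {f : 𝓢'(RSp ι, ℂ)}
    (hf : f ∈ modulationSpace g p s) : wignerDistrib U f f ∈ weightedLp p s := by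
  obtain ⟨T, hTW⟩ : ∃ T : 𝓢(RSp (ι ⊕ ι), ℂ) →L[ℂ] ℂ, ∀ φ, T φ = wignerDistrib U f f φ :=
    ⟨⟨(wignerDistrib U f f).toLinearMap, (wignerDistrib U f f).continuous⟩, fun _ => rfl⟩
  obtain ⟨h, hh⟩ : ∃ h, h = schwartzConj (U (tensorRSp g (schwartzConj g))) := ⟨_, rfl⟩
  have hh0 : h ≠ 0 := by
    rw [hh]
    exact schwartzConj_ne_zero
      (U.map_ne_zero_iff.2 (tensorRSp_ne_zero hg (schwartzConj_ne_zero hg)))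
  have hf' : MemLp (fun z => (polyWeight s z : ℂ) * stft g f z) p volume := hf
  have hpt : p ≠ ⊤ := (hp2.trans_lt ENNReal.ofNat_lt_top).ne
  obtain ⟨L, hL⟩ : ∃ L : (RSp (ι ⊕ ι) × RSp (ι ⊕ ι)) ≃L[ℝ] (RSp (ι ⊕ ι) × RSp (ι ⊕ ι)),
      ∀ z, ‖T (atom h z.1 z.2)‖ ≤ ‖stft g f (L z).1‖ * ‖stft g f (L z).2‖ := by
    refine ⟨wignerPhaseEquiv A hU.tfShift_comm.1, fun z => ?_⟩
    rw [hTW, hh]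
    exact (norm_wignerDistrib_atom hU g f z).le
  obtain ⟨P, hP⟩ : ∃ P, P = stft g f := ⟨_, rfl⟩
  rw [← hP] at hf' hL
  have hT := memLp_weight_of_le_mul (V := RSp (ι ⊕ ι)) (X := RSp (ι ⊕ ι)) (Y := RSp (ι ⊕ ι)) L
    volume volume volume hp1 hpt hs hf' hf' (continuous_apply_atom T h) hL
  obtain ⟨F, hF, hTF⟩ := exists_memLp_weight_of_stft T hh0 hp1 hp2 hs hT
  exact ⟨F, hF, fun φ => (hTW φ).symm.trans (hTF φ)⟩

end WignerShortTime

/-! ### A weighted Young inequality -/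

section WeightedYoung

variable {V : Type} [NormedAddCommGroup V] [NormedSpace ℝ V] [FiniteDimensional ℝ V]
  [MeasurableSpace V] [BorelSpace V] (μ : Measure V) [μ.IsAddHaarMeasure]

/-- Jensen's inequality for the measure `|b| ν`, which need not be normalized. -/
theorem lintegral_mul_rpow_le {α : Type} [MeasurableSpace α] {ν : Measure α} {p : ℝ≥0∞}
    (hp1 : 1 ≤ p) (hpt : p ≠ ⊤) {a b : α → ℂ} (ha : AEStronglyMeasurable a ν)
    (hb : AEMeasurable b ν) :
    (∫⁻ x, ‖b x‖ₑ * ‖a x‖ₑ ∂ν) ^ p.toReal ≤ (∫⁻ x, ‖b x‖ₑ * ‖a x‖ₑ ^ p.toReal ∂ν)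
      * ((∫⁻ x, ‖b x‖ₑ ∂ν) ^ (1 - 1 / p.toReal)) ^ p.toReal := by
  have hp0 : p ≠ 0 := (zero_lt_one.trans_le hp1).ne'
  set ρ := ν.withDensity fun x => ‖b x‖ₑ with hρ
  have ha' : AEStronglyMeasurable a ρ := ha.mono_ac (withDensity_absolutelyContinuous _ _)
  have h := ENNReal.rpow_le_rpow (eLpNorm_le_eLpNorm_mul_rpow_measure_univ (μ := ρ) hp1 ha')
    (ENNReal.toReal_nonneg (a := p))
  rw [ENNReal.mul_rpow_of_nonneg _ _ ENNReal.toReal_nonneg, eLpNorm_rpow_toReal hp0 hpt,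
    eLpNorm_one_eq_lintegral_enorm, ENNReal.toReal_one, div_one,
    lintegral_withDensity_eq_lintegral_mul₀ hb.enorm ha.enorm,
    lintegral_withDensity_eq_lintegral_mul₀ hb.enorm (ha.enorm.pow_const _),
    withDensity_apply _ MeasurableSet.univ, Measure.restrict_univ] at h
  exact h

/-- Young's inequality with weights: `‖v_s (|F| * |Φ|)‖_p` is finite for `v_s F ∈ L^p` and
`v_s Φ ∈ L^1`, because `v_s` is submultiplicative up to a constant. -/
theorem lintegral_weight_correlation_lt_top {p : ℝ≥0∞} (hp1 : 1 ≤ p) (hpt : p ≠ ⊤) {s : ℝ}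
    (hs : 0 ≤ s) {F : V → ℂ} (hF : MemLp (fun z => (polyWeight s z : ℂ) * F z) p μ) {Φ : V → ℂ}
    (hΦ : Continuous Φ) (hΦi : ∫⁻ z, ‖(polyWeight s z : ℂ) * Φ z‖ₑ ∂μ < ⊤) :
    ∫⁻ y, (‖(polyWeight s y : ℂ)‖ₑ * ∫⁻ z, ‖F z‖ₑ * ‖Φ (z - y)‖ₑ ∂μ) ^ p.toReal ∂μ < ⊤ := by
  have hp0 : p ≠ 0 := (zero_lt_one.trans_le hp1).ne'
  set r := p.toReal with hr
  have hr0 : 0 < r := ENNReal.toReal_pos hp0 hpt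
  have hr1 : 1 ≤ r := by
    rw [hr, ← ENNReal.toReal_one]; exact ENNReal.toReal_mono hpt hp1
  -- the constant of `polyWeight_le_mul` for `L = 1`
  set c : ℝ := (2 * 1 ^ 2) ^ (s / 2) with hcdef
  have hc0 : 0 ≤ c := by positivity
  set a : V → ℂ := fun z => (polyWeight s z : ℂ) * F z with ha
  set b : V → ℂ := fun z => (polyWeight s z : ℂ) * Φ z with hb
  have hbc : Continuous b := (Complex.continuous_ofReal.comp (continuous_polyWeight s)).mul hΦ
  set B := ∫⁻ z, ‖b z‖ₑ ∂μ with hB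
  set D : ℝ≥0∞ := (B ^ (1 - 1 / r)) ^ r with hD
  have hDt : D ≠ ⊤ := by
    refine ENNReal.rpow_ne_top_of_nonneg hr0.le (ENNReal.rpow_ne_top_of_nonneg ?_ hΦi.ne)
    rw [sub_nonneg, div_le_one hr0]; exact hr1
  have hpt1 : ∀ y z, ‖(polyWeight s y : ℂ)‖ₑ * (‖F z‖ₑ * ‖Φ (z - y)‖ₑ)
      ≤ ‖(c : ℂ)‖ₑ * (‖b (z - y)‖ₑ * ‖a z‖ₑ) := by
    intro y z
    rw [← enorm_mul, ← enorm_mul, ← enorm_mul, ← enorm_mul, enorm_le_iff_norm_le]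
    have h1 : ‖y‖ ≤ 1 * (‖z‖ + ‖z - y‖) := by
      rw [one_mul]
      calc ‖y‖ = ‖z - (z - y)‖ := by rw [sub_sub_cancel]
        _ ≤ _ := norm_sub_le _ _
    have h2 := polyWeight_le_mul hs le_rfl h1
    simp only [a, b, norm_mul, Complex.norm_real, Real.norm_of_nonneg hc0,
      Real.norm_of_nonneg (polyWeight_pos s _).le]
    calc _ ≤ (c * (polyWeight s z * polyWeight s (z - y))) * (‖F z‖ * ‖Φ (z - y)‖) := by gcongr
      _ = _ := by ring
  have hinner : ∀ y, (‖(polyWeight s y : ℂ)‖ₑ * ∫⁻ z, ‖F z‖ₑ * ‖Φ (z - y)‖ₑ ∂μ) ^ r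
      ≤ ‖(c : ℂ)‖ₑ ^ r * D * ∫⁻ z, ‖b (z - y)‖ₑ * ‖a z‖ₑ ^ r ∂μ := by
    intro y
    have h1 := lintegral_mul_rpow_le (ν := μ) hp1 hpt (a := a) (b := fun z => b (z - y)) hF.1
      (hbc.comp (continuous_id.sub continuous_const)).measurable.aemeasurable
    rw [lintegral_sub_right_eq_self (fun z => ‖b z‖ₑ) y] at h1
    calc _ = (∫⁻ z, ‖(polyWeight s y : ℂ)‖ₑ * (‖F z‖ₑ * ‖Φ (z - y)‖ₑ) ∂μ) ^ r := by
          rw [lintegral_const_mul' _ _ enorm_ne_top]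
      _ ≤ (∫⁻ z, ‖(c : ℂ)‖ₑ * (‖b (z - y)‖ₑ * ‖a z‖ₑ) ∂μ) ^ r := by
          exact ENNReal.rpow_le_rpow (lintegral_mono (hpt1 y)) hr0.le
      _ = ‖(c : ℂ)‖ₑ ^ r * (∫⁻ z, ‖b (z - y)‖ₑ * ‖a z‖ₑ ∂μ) ^ r := by
          rw [lintegral_const_mul' _ _ enorm_ne_top, ENNReal.mul_rpow_of_nonneg _ _ hr0.le]
      _ ≤ ‖(c : ℂ)‖ₑ ^ r * ((∫⁻ z, ‖b (z - y)‖ₑ * ‖a z‖ₑ ^ r ∂μ) * D) := by gcongr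
      _ = _ := by ring
  have hswap : ∫⁻ y, ∫⁻ z, ‖b (z - y)‖ₑ * ‖a z‖ₑ ^ r ∂μ ∂μ = B * ∫⁻ z, ‖a z‖ₑ ^ r ∂μ := by
    rw [lintegral_lintegral_swap]
    · rw [← lintegral_const_mul' _ _ hΦi.ne]
      refine lintegral_congr fun z => ?_
      rw [lintegral_mul_const' _ _ (ENNReal.rpow_ne_top_of_nonneg hr0.le enorm_ne_top),
        lintegral_sub_left_eq_self (fun y => ‖b y‖ₑ) z]
    · refine AEMeasurable.mul ?_ ?_
      · exact (hbc.comp (continuous_snd.sub continuous_fst)).enorm.measurable.aemeasurable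
      · exact (hF.1.enorm.pow_const r).comp_snd
  have hcD : ‖(c : ℂ)‖ₑ ^ r * D ≠ ⊤ :=
    ENNReal.mul_ne_top (ENNReal.rpow_ne_top_of_nonneg hr0.le enorm_ne_top) hDt
  refine (lintegral_mono hinner).trans_lt ?_
  rw [lintegral_const_mul' _ _ hcD, hswap]
  exact ENNReal.mul_lt_top hcD.lt_top (ENNReal.mul_lt_top hΦi
    ((eLpNorm_lt_top_iff_lintegral_rpow_enorm_lt_top hp0 hpt).1 hF.2))

end WeightedYoung

/-! ### Shift-invertible Wigner distributions -/

section ShiftInvertible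

open ComplexConjugate

theorem lintegral_weight_schwartz_lt_top {V : Type} [NormedAddCommGroup V] [InnerProductSpace ℝ V]
    [FiniteDimensional ℝ V] [MeasurableSpace V] [BorelSpace V] (s : ℝ) (φ : 𝓢(V, ℂ)) :
    ∫⁻ z, ‖(polyWeight s z : ℂ) * φ z‖ₑ < ⊤ := by
  have hw : Function.HasTemperateGrowth fun z : V => polyWeight s z :=
    Function.hasTemperateGrowth_one_add_norm_sq_rpow V (s / 2)
  have h1 := (smulLeftCLM ℂ (fun z : V => polyWeight s z) φ).integrable (μ := volume)
  refine lt_of_eq_of_lt (lintegral_congr fun z => ?_) h1.2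
  rw [smulLeftCLM_apply_apply hw, Complex.real_smul]

variable {ι : Type} [Fintype ι] {U : 𝓢(RSp (ι ⊕ ι), ℂ) ≃L[ℂ] 𝓢(RSp (ι ⊕ ι), ℂ)}

/-- The short-time Fourier transform of `f` is dominated by the correlation of `W_A f` with the Schwartz
function `W_A(g, γ)`, evaluated at `E w`. The factor `⟨f, γ⟩` comes from the second copy of `f` in
`W_A f`. -/
theorem enorm_stft_mul_le {E : Matrix (ι ⊕ ι) (ι ⊕ ι) ℝ} {g γ : 𝓢(RSp ι, ℂ)} {w : RSp (ι ⊕ ι)}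
    (hE : ∀ᵐ z, ‖U (tensorRSp (tfShiftSchwartz w g) (schwartzConj γ)) z‖
      = ‖U (tensorRSp g (schwartzConj γ)) (z - WithLp.toLp 2 (E.mulVec w.ofLp))‖)
    {f : 𝓢'(RSp ι, ℂ)} {F : RSp (ι ⊕ ι) → ℂ}
    (hF : ∀ φ : 𝓢(RSp (ι ⊕ ι), ℂ), wignerDistrib U f f φ = ∫ z, φ z * F z) :
    ‖stft g f w‖ₑ * ‖f (schwartzConj γ)‖ₑ ≤ ∫⁻ z, ‖F z‖ₑ
      * ‖U (tensorRSp g (schwartzConj γ)) (z - WithLp.toLp 2 (E.mulVec w.ofLp))‖ₑ := by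
  have h1 : stft g f w * conj (f (schwartzConj γ)) = wignerDistrib U f f
      (schwartzConj (U (tensorRSp (tfShiftSchwartz w g) (schwartzConj γ)))) := by
    rw [wignerDistrib_schwartzConj, schwartzConj_tensorRSp, tensorDistrib_tensorRSp,
      conjDistrib_apply, schwartzConj_schwartzConj]
    rfl
  have h2 : ‖f (schwartzConj γ)‖ₑ = ‖conj (f (schwartzConj γ))‖ₑ := by
    rw [← ofReal_norm, ← ofReal_norm, RCLike.norm_conj]
  rw [h2, ← enorm_mul, h1, hF]
  refine (enorm_integral_le_lintegral_enorm _).trans_eq (lintegral_congr_ae ?_)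
  filter_upwards [hE] with z hz
  rw [enorm_mul, mul_comm, schwartzConj_apply, ← ofReal_norm (conj _), RCLike.norm_conj, hz,
    ofReal_norm]

variable [DecidableEq ι] {A : Matrix ((ι ⊕ ι) ⊕ (ι ⊕ ι)) ((ι ⊕ ι) ⊕ (ι ⊕ ι)) ℝ}

/-- On Schwartz functions, where `W_A (a, b)` is the function `U (a ⊗ b̄)`, shift-invertibility is a
statement about functions. -/
theorem IsShiftInvertible.exists_norm_eq (hE : IsShiftInvertible U) (hU : IsMetaplectic A U) :
    ∃ E : Matrix (ι ⊕ ι) (ι ⊕ ι) ℝ, IsUnit E.det ∧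
      ∀ (a b : 𝓢(RSp ι, ℂ)) (w : RSp (ι ⊕ ι)),
        ∀ᵐ z, ‖U (tensorRSp (tfShiftSchwartz w a) (schwartzConj b)) z‖
          = ‖U (tensorRSp a (schwartzConj b)) (z - WithLp.toLp 2 (E.mulVec w.ofLp))‖ := by
  obtain ⟨E, hEu, h⟩ := hE
  refine ⟨E, hEu, fun a b w => ?_⟩
  obtain ⟨F, G, hF, hG, hFG⟩ := h a b (a.memLp 2) (b.memLp 2) w
  have key : ∀ (K : Lp ℂ 2 (volume : Measure (RSp (ι ⊕ ι)))) (S T : 𝓢'(RSp ι, ℂ))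
      (a b : 𝓢(RSp ι, ℂ)) (_ : ∀ φ : 𝓢(RSp ι, ℂ), S φ = ∫ x, φ x * a x)
      (_ : ∀ φ : 𝓢(RSp ι, ℂ), T φ = ∫ y, φ y * b y)
      (_ : Lp.toTemperedDistribution K = wignerDistrib U S T),
      K =ᵐ[volume] U (tensorRSp a (schwartzConj b)) := by
    intro K S T a b hS hT hK
    refine ae_eq_of_forall_integral_schwartz_eq one_le_two (Lp.memLp K)
      ((U (tensorRSp a (schwartzConj b))).memLp 2 volume) fun ψ => ?_
    rw [← wignerDistrib_of_integral U hU S T a b hS hT ψ, ← hK, Lp.toTemperedDistribution_apply]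
    simp only [smul_eq_mul]
  have h1 := key F _ _ (tfShiftSchwartz w a) b (fun φ => by
      simp only [toTemperedDistribution_toLp_apply, tfShiftSchwartz_apply])
    (toTemperedDistribution_toLp_apply _) hF
  have h2 := key G _ _ a b (toTemperedDistribution_toLp_apply _)
    (toTemperedDistribution_toLp_apply _) hG
  have h3 := (measurePreserving_sub_right (volume : Measure (RSp (ι ⊕ ι)))
    (WithLp.toLp 2 (E.mulVec w.ofLp))).quasiMeasurePreserving.ae_eq_comp h2
  filter_upwards [h1, h3, hFG] with z hz1 hz3 hz
  rw [← hz1, hz]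
  exact congrArg norm hz3

/-- The bound `enorm_stft_mul_le`, with `γ` such that `⟨f, γ⟩ ≠ 0`, reduces the claim to the weighted
Young inequality. -/
theorem mem_modulationSpace (hU : IsMetaplectic A U) (hE : IsShiftInvertible U) {p : ℝ≥0∞}
    (hp1 : 1 ≤ p) (hpt : p ≠ ⊤) {s : ℝ} (hs : 0 ≤ s) (g : 𝓢(RSp ι, ℂ)) {f : 𝓢'(RSp ι, ℂ)}
    (hf : wignerDistrib U f f ∈ weightedLp p s) : f ∈ modulationSpace g p s := by
  have hp0 : p ≠ 0 := (zero_lt_one.trans_le hp1).ne'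
  obtain ⟨F, hF, hFW⟩ := hf
  have hF' : MemLp (fun z => (polyWeight s z : ℂ) * F z) p volume := hF
  obtain ⟨E, hEu, hEn⟩ := hE.exists_norm_eq hU
  change MemLp (fun z => (polyWeight s z : ℂ) * stft g f z) p volume
  -- if `f` vanishes, there is no `γ` to divide by, and its short-time Fourier transform is zero
  by_cases h0 : ∀ γ, f (schwartzConj γ) = 0
  · have : (fun z => (polyWeight s z : ℂ) * stft g f z) = fun _ => 0 := by
      funext z
      rw [stft, h0, mul_zero]
    rw [this]
    exact MemLp.zero
  push Not at h0
  obtain ⟨γ, hγ⟩ := h0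
  set r := p.toReal with hr
  have hr0 : 0 < r := ENNReal.toReal_pos hp0 hpt
  set Φ := U (tensorRSp g (schwartzConj γ)) with hΦ
  let e := mulVecEquiv E hEu
  set D := max 1 ‖(e.symm : RSp (ι ⊕ ι) →L[ℝ] RSp (ι ⊕ ι))‖ with hD
  set c : ℝ := (2 * D ^ 2) ^ (s / 2) with hcdef
  have hc0 : 0 ≤ c := by positivity
  have hw : ∀ x : RSp (ι ⊕ ι), ‖(polyWeight s x : ℂ)‖ₑ ≤ ‖(c : ℂ)‖ₑ * ‖(polyWeight s (e x) : ℂ)‖ₑ := by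
    intro x
    rw [← enorm_mul, enorm_le_iff_norm_le]
    have h1 : ‖x‖ ≤ D * ‖e x‖ := by
      calc ‖x‖ = ‖(e.symm : RSp (ι ⊕ ι) →L[ℝ] RSp (ι ⊕ ι)) (e x)‖ := by simp
        _ ≤ ‖(e.symm : RSp (ι ⊕ ι) →L[ℝ] RSp (ι ⊕ ι))‖ * ‖e x‖ := ContinuousLinearMap.le_opNorm _ _
        _ ≤ D * ‖e x‖ := by gcongr; exact le_max_right _ _
    have h2 := polyWeight_le_of_norm_le hs (le_max_left _ _) h1
    simp only [norm_mul, Complex.norm_real, Real.norm_of_nonneg hc0,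
      Real.norm_of_nonneg (polyWeight_pos s _).le]
    exact h2
  set K : RSp (ι ⊕ ι) → ℝ≥0∞ := fun y =>
    (‖(polyWeight s y : ℂ)‖ₑ * ∫⁻ z, ‖F z‖ₑ * ‖Φ (z - y)‖ₑ) ^ r with hK
  have hKi : ∫⁻ y, K y < ⊤ := lintegral_weight_correlation_lt_top volume hp1 hpt hs hF'
    Φ.continuous (lintegral_weight_schwartz_lt_top s Φ)
  have hKe : ∫⁻ x, K (e x) < ⊤ := lintegral_comp_equiv_lt_top e volume volume hKi
  have hcont : Continuous fun z => (polyWeight s z : ℂ) * stft g f z :=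
    (Complex.continuous_ofReal.comp (continuous_polyWeight s)).mul (continuous_stft g f)
  refine ⟨hcont.aestronglyMeasurable, ?_⟩
  rw [eLpNorm_lt_top_iff_lintegral_rpow_enorm_lt_top hp0 hpt]
  set β := ‖f (schwartzConj γ)‖ₑ with hβ
  have hβ0 : β ≠ 0 := enorm_ne_zero.2 hγ
  have hle : ∀ x, ‖(polyWeight s x : ℂ) * stft g f x‖ₑ ^ r * β ^ r ≤ ‖(c : ℂ)‖ₑ ^ r * K (e x) := by
    intro x
    have h1 := enorm_stft_mul_le (hEn g γ x) hFW
    rw [hK, ← ENNReal.mul_rpow_of_nonneg _ _ hr0.le, ← ENNReal.mul_rpow_of_nonneg _ _ hr0.le,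
      enorm_mul]
    refine ENNReal.rpow_le_rpow ?_ hr0.le
    calc _ = ‖(polyWeight s x : ℂ)‖ₑ * (‖stft g f x‖ₑ * β) := mul_assoc _ _ _
      _ ≤ (‖(c : ℂ)‖ₑ * ‖(polyWeight s (e x) : ℂ)‖ₑ) * ∫⁻ z, ‖F z‖ₑ * ‖Φ (z - e x)‖ₑ :=
          mul_le_mul' (hw x) h1
      _ = _ := mul_assoc _ _ _
  have hcr : ‖(c : ℂ)‖ₑ ^ r ≠ ⊤ := ENNReal.rpow_ne_top_of_nonneg hr0.le enorm_ne_top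
  have htot : (∫⁻ x, ‖(polyWeight s x : ℂ) * stft g f x‖ₑ ^ r) * β ^ r < ⊤ := by
    rw [← lintegral_mul_const' _ _ (ENNReal.rpow_ne_top_of_nonneg hr0.le enorm_ne_top)]
    refine (lintegral_mono hle).trans_lt ?_
    rw [lintegral_const_mul' _ _ hcr]
    exact ENNReal.mul_lt_top hcr.lt_top hKe
  by_contra hcon
  rw [not_lt, top_le_iff] at hcon
  rw [hcon, ENNReal.top_mul (by simp [ENNReal.rpow_eq_zero_iff, hβ0, hr0.not_gt])] at htot
  exact lt_irrefl _ htot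

end ShiftInvertible
end TimeFreq

theorem corollary2p14 (d : ℕ) (s : ℝ) (hs : 0 ≤ s) (p : ℝ≥0∞) (hp1 : 1 ≤ p) (hp2 : p ≤ 2)
    (A : Matrix ((Fin d ⊕ Fin d) ⊕ (Fin d ⊕ Fin d)) ((Fin d ⊕ Fin d) ⊕ (Fin d ⊕ Fin d)) ℝ)
    (hA : A ∈ Matrix.symplecticGroup (Fin d ⊕ Fin d) ℝ)
    (U : 𝓢(RSp (Fin d ⊕ Fin d), ℂ) ≃L[ℂ] 𝓢(RSp (Fin d ⊕ Fin d), ℂ))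
    (hU : IsMetaplectic A U) (hE : IsShiftInvertible U)
    (g : 𝓢(RSp (Fin d), ℂ)) (hg : g ≠ 0) (f : 𝓢'(RSp (Fin d), ℂ)) :
    f ∈ modulationSpace g p s ↔ wignerDistrib U f f ∈ weightedLp p s :=
  ⟨wignerDistrib_mem_weightedLp hU hp1 hp2 hs hg,
    mem_modulationSpace hU hE hp1 (hp2.trans_lt ENNReal.ofNat_lt_top).ne hs g⟩
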